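/- Fix an integer $d\ge 2$ and, for real $\delta<d-1$, put $p=p_n=n^{-d+1+\delta}$. Let $\mathcal H$ be the random $d$-uniform hypergraph on $[n]$ in which each of the $\binom nd$ possible hyperedges is present independently with probability $p$. For a hypergraph $H$, let $\mathrm{Proj}(H)$ be the simple graph on the same vertices in which two distinct vertices are adjacent iff some hyperedge of $H$ contains both. *Critical threshold.* Exact recovery is possible at $\delta$ if there are maps $\mathcal A=\mathcal A_n$ from graphs on $[n]$ to hypergraphs on $[n]$ with $\Pr(\mathcal A(\mathrm{Proj}(\mathcal H))=\mathcal H)\to 1$ as $n\to\infty$. Let $\delta_c(d)$ be the supremum of the $\delta<d-1$ at which exact recovery is possible. *Ambiguity threshold.* A preimage of a graph $G$ is a $d$-uniform hypergraph $H$ on the vertex set of $G$ with $\mathrm{Proj}(H)=G$; it is a minimum preimage if it has the least number of hyperedges among all preimages. A finite graph is ambiguous if it has at least two minimum preimages. For a graph $G$, let $\mathrm{Cli}(G)$ be the set of all $d$-vertex cliques of $G$, regarded as a $d$-uniform hypergraph. The 2-connected components of a hypergraph are the connected components of the graph whose nodes are its hyperedges, two of them being adjacent iff they share at least two vertices. A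 fixed finite graph $G_a$ appears as a 2-connected component if, for some copy $G'$ of $G_a$ on vertices of $[n]$, $\mathrm{Cli}(G')$ is a 2-connected component of $\mathrm{Cli}(\mathrm{Proj}(\mathcal H))$. Let $\delta_d^a$ be the infimum of the $\delta<d-1$ for which there exist a fixed finite ambiguous graph $G_a$ and a constant $c>0$ such that, for all sufficiently large $n$, $G_a$ appears as a 2-connected component with probability at least $c$. **Corollary.** Let $d\in\{3,4,5\}$. Both thresholds are well-defined real numbers (the infimum is over a nonempty set bounded below, the supremum over a nonempty set bounded above), and $$\delta_d^a\le\frac{d-1}{d+1},\qquad\text{and hence}\qquad \delta_c(d)=\delta_d^a .$$ Moreover $\delta_c(d)$ is a sharp threshold: exact recovery is possible for every $\delta<\delta_c(d)$ and is not possible for any $\delta$ with $\delta_c(d)<\delta<d-1$. -/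

import Mathlib

open Filter Topology

noncomputable section

namespace HypergraphProjection

/-! ### Hypergraphs, projections, preimages

A `d`-uniform hypergraph on the vertex set `V` is given by its finite set of hyperedges
`H : Finset (Finset V)`, all of cardinality `d` (`Set.Sized`). -/

/-- The projection of a hypergraph: the simple graph on the same vertices in which two distinct
vertices are adjacent iff some hyperedge contains both. -/
def proj {V : Type*} (H : Finset (Finset V)) : SimpleGraph V where
  Adj u v := u ≠ v ∧ ∃ h ∈ H, u ∈ h ∧ v ∈ h
  symm := ⟨fun _ _ huv => ⟨huv.1.symm, huv.2.imp fun _ h => ⟨h.1, h.2.2, h.2.1⟩⟩⟩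
  loopless := ⟨fun _ hu => hu.1 rfl⟩

/-- `H` is a preimage of the graph `G`: a `d`-uniform hypergraph with projection `G`. -/
def IsPreimage {V : Type*} (d : ℕ) (G : SimpleGraph V) (H : Finset (Finset V)) : Prop :=
  (H : Set (Finset V)).Sized d ∧ proj H = G

/-- A minimum preimage: a preimage with the least number of hyperedges. -/
def IsMinPreimage {V : Type*} (d : ℕ) (G : SimpleGraph V) (H : Finset (Finset V)) : Prop :=
  IsPreimage d G H ∧ ∀ H' : Finset (Finset V), IsPreimage d G H' → H.card ≤ H'.card

/-- An ambiguous graph: a graph with at least two minimum preimages. -/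
def IsAmbiguous {V : Type*} (d : ℕ) (G : SimpleGraph V) : Prop :=
  ∃ H₁ H₂ : Finset (Finset V), H₁ ≠ H₂ ∧ IsMinPreimage d G H₁ ∧ IsMinPreimage d G H₂

/-! ### 2-connected components -/

/-- The graph whose nodes are the hyperedges in `K`, two of them being adjacent iff they
share at least two vertices. -/
def twoNeighborGraph {V : Type*} [DecidableEq V] (K : Set (Finset V)) : SimpleGraph K where
  Adj h h' := h ≠ h' ∧ 2 ≤ ((h : Finset V) ∩ (h' : Finset V)).card
  symm := ⟨fun _ _ hh => ⟨hh.1.symm, by rw [Finset.inter_comm]; exact hh.2⟩⟩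
  loopless := ⟨fun _ hh => hh.1 rfl⟩

/-- `C` is a 2-connected component of the hypergraph with hyperedge set `K`. -/
def IsTwoConnComponent {V : Type*} [DecidableEq V] (K C : Set (Finset V)) : Prop :=
  ∃ c : (twoNeighborGraph K).ConnectedComponent, C = Subtype.val '' c.supp

/-- The graph `G` has a copy of `Ga` as a 2-connected component: for some injection `φ` of the
vertices of `Ga` into those of `G`, the set of `d`-cliques of the copy `φ(Ga)` is a 2-connected
component of the clique hypergraph of `G` (the hypergraph of all `d`-cliques of `G`). -/
def AppearsAsComponent {W V : Type*} [DecidableEq V] (d : ℕ) (Ga : SimpleGraph W)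
    (G : SimpleGraph V) : Prop :=
  ∃ φ : W ↪ V, IsTwoConnComponent (G.cliqueSet d) ((Ga.map φ).cliqueSet d)

/-! ### The random hypergraph -/

/-- All possible hyperedges: the `d`-subsets of the `n` vertices. -/
def allHyperedges (n d : ℕ) : Finset (Finset (Fin n)) :=
  Finset.powersetCard d Finset.univ

open Classical in
/-- The probability that the random `d`-uniform hypergraph on `n` vertices, in which each of the
`n.choose d` hyperedges is present independently with probability `p`, has property `E`. -/
def prob (n d : ℕ) (p : ℝ) (E : Finset (Finset (Fin n)) → Prop) : ℝ :=
  ∑ H ∈ (allHyperedges n d).powerset with E H, p ^ H.card * (1 - p) ^ (n.choose d - H.card)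

/-- The weights form a probability distribution. -/
theorem prob_true (n d : ℕ) (p : ℝ) : prob n d p (fun _ => True) = 1 := by
  have h := Finset.sum_pow_mul_eq_add_pow p (1 - p) (allHyperedges n d)
  have hc : (allHyperedges n d).card = n.choose d := by simp [allHyperedges]
  rw [hc] at h
  simp only [prob, Finset.filter_true, h]
  simp

/-- The hyperedge probability `p = n ^ (-d + 1 + δ)`. -/
def edgeProb (d : ℕ) (δ : ℝ) (n : ℕ) : ℝ := (n : ℝ) ^ (-(d : ℝ) + 1 + δ)

/-- In the range `δ < d - 1`, the quantity `n ^ (-d + 1 + δ)` is a probability for every `n`. -/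
theorem edgeProb_mem (d : ℕ) (δ : ℝ) (hδ : δ < (d : ℝ) - 1) (n : ℕ) :
    0 ≤ edgeProb d δ n ∧ edgeProb d δ n ≤ 1 := by
  refine ⟨Real.rpow_nonneg (Nat.cast_nonneg n) _, ?_⟩
  have hneg : -(d : ℝ) + 1 + δ < 0 := by linarith
  rcases Nat.eq_zero_or_pos n with rfl | hn
  · simp [edgeProb, Real.zero_rpow hneg.ne]
  · exact Real.rpow_le_one_of_one_le_of_nonpos (by exact_mod_cast hn) hneg.le

/-! ### The two thresholds -/

/-- Exact recovery is possible at density `δ`: some recovery algorithm (a map from graphs to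
hypergraphs, for each `n`) recovers the random hypergraph from its projection with
probability `1 - o(1)`. -/
def ExactRecoveryPossible (d : ℕ) (δ : ℝ) : Prop :=
  ∃ A : ∀ n : ℕ, SimpleGraph (Fin n) → Finset (Finset (Fin n)),
    Tendsto (fun n : ℕ => prob n d (edgeProb d δ n) fun H => A n (proj H) = H) atTop (𝓝 1)

/-- The densities at which exact recovery is possible. -/
def recoverableDensities (d : ℕ) : Set ℝ :=
  {δ | δ < (d : ℝ) - 1 ∧ ExactRecoveryPossible d δ}

/-- The critical threshold for exact recovery. -/
def criticalThreshold (d : ℕ) : ℝ := sSup (recoverableDensities d)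

/-- The densities at which some fixed finite ambiguous graph appears as a 2-connected component
of the clique hypergraph of the projected graph with probability `Ω(1)`. -/
def ambiguousDensities (d : ℕ) : Set ℝ :=
  {δ | δ < (d : ℝ) - 1 ∧ ∃ (m : ℕ) (Ga : SimpleGraph (Fin m)), IsAmbiguous d Ga ∧
    ∃ c : ℝ, 0 < c ∧ ∀ᶠ n : ℕ in atTop,
      c ≤ prob n d (edgeProb d δ n) fun H => AppearsAsComponent d Ga (proj H)}

/-- The ambiguity threshold. -/
def ambiguityThreshold (d : ℕ) : ℝ := sInf (ambiguousDensities d)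

end HypergraphProjection

end

namespace HypergraphProjection

section Combinatorics

variable {V : Type*} {d : ℕ}

/-! ### Projections, cliques and restrictions -/

/-! Write `β = d - 1 - δ`, so that `p = n ^ (-β)` and a pattern with `s` hyperedges on `v` vertices
has about `n ^ (v - β s)` expected copies. The critical value `δ = (d-1)/(d+1)` is `β =
d(d-1)/(d+1)`. The argument compares vertices with hyperedges inside a 2-connected component.

Growth. A component grows by completing a clique that shares two vertices with the part already
explored. By convexity, `T` new hyperedges doing so add at most `d(d-1)/(d+1)` vertices each
(`card_biUnion_sdiff_le`). Hence, for larger `β`, large components are too dense to occur in a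
typical hypergraph.

Below the critical value. The algorithm returns a minimum preimage. If it fails on a typical
hypergraph, then it fails inside one bounded component, and for `d ≥ 3` the growth bound makes the
true hyperedges of that component a minimum preimage too: its graph is ambiguous, and every subset
of its hyperedges spans at least `β` vertices per hyperedge (`exists_isObstruction`). Conversely, up
to and including the critical value, such an obstruction appears as a component with probability
bounded below, by Harris' inequality for isolation and the second moment method
(`exists_le_prob_appearsAsComponent`). So non-ambiguous densities below the critical value are
recoverable (`exactRecoveryPossible_of_notMem`), and ambiguity persists upwards as far as the
critical value (`mem_ambiguousDensities_of_le`).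

Impossibility. An ambiguous component can be exchanged for a preimage that is at least as likely, so
every algorithm fails with positive probability (`not_exactRecoveryPossible_of_mem`). Above the
critical value, counting graphs by their edges against the spread of the random hypergraph rules out
recovery (`not_exactRecoveryPossible_of_critical_lt`).

The restriction `d ≤ 5` enters only through an explicit ambiguous gadget that is sparse enough to
appear at the critical value itself (`spans_gadget`). This puts the ambiguity threshold at or below
it, and the two regimes then meet. -/

theorem proj_mono {H H' : Finset (Finset V)} (h : H ⊆ H') : proj H ≤ proj H' :=
  fun _ _ huv => ⟨huv.1, huv.2.imp fun _ ht => ⟨h ht.1, ht.2⟩⟩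

theorem mem_cliqueSet_proj {H : Finset (Finset V)} {c : Finset V} :
    c ∈ (proj H).cliqueSet d ↔
      (∀ u ∈ c, ∀ v ∈ c, u ≠ v → ∃ h ∈ H, u ∈ h ∧ v ∈ h) ∧ c.card = d := by
  rw [SimpleGraph.mem_cliqueSet_iff, SimpleGraph.isNClique_iff, SimpleGraph.isClique_iff]
  refine and_congr_left fun _ => ⟨fun h u hu v hv huv => (h hu hv huv).2,
    fun h u hu v hv huv => ⟨huv, h u hu v hv huv⟩⟩

theorem subset_cliqueSet_proj {H : Finset (Finset V)} (hH : (H : Set (Finset V)).Sized d) :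
    (H : Set (Finset V)) ⊆ (proj H).cliqueSet d :=
  fun h hh => mem_cliqueSet_proj.2 ⟨fun _ hu _ hv _ => ⟨h, hh, hu, hv⟩, hH hh⟩

theorem proj_eq_of_cliqueSet_eq {H H' : Finset (Finset V)}
    (hH : (H : Set (Finset V)).Sized d) (hH' : (H' : Set (Finset V)).Sized d)
    (h : (proj H).cliqueSet d = (proj H').cliqueSet d) : proj H = proj H' := by
  have key : ∀ {A B : Finset (Finset V)}, (A : Set (Finset V)).Sized d →
      (proj A).cliqueSet d = (proj B).cliqueSet d → proj A ≤ proj B := by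
    intro A B hA hAB u v ⟨huv, t, ht, hu, hv⟩
    have := subset_cliqueSet_proj hA ht
    rw [hAB] at this
    exact ⟨huv, (mem_cliqueSet_proj.1 this).1 u hu v hv huv⟩
  exact le_antisymm (key hH h) (key hH' h.symm)

theorem exists_ne_of_two_le_card {s : Finset V} (h : 2 ≤ s.card) (u : V) :
    ∃ v ∈ s, u ≠ v := by
  obtain ⟨v, hv, hne⟩ := Finset.exists_mem_ne (by omega : 1 < s.card) u
  exact ⟨v, hv, hne.symm⟩

open Classical in
/-- The hyperedges of `H` which belong to `C`. -/
noncomputable def restrict (H : Finset (Finset V)) (C : Set (Finset V)) : Finset (Finset V) :=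
  H.filter (· ∈ C)

theorem mem_restrict {H : Finset (Finset V)} {C : Set (Finset V)} {h : Finset V} :
    h ∈ restrict H C ↔ h ∈ H ∧ h ∈ C := by
  simp [restrict]

theorem restrict_subset (H : Finset (Finset V)) (C : Set (Finset V)) : restrict H C ⊆ H :=
  fun _ hh => (mem_restrict.1 hh).1

theorem restrict_sized {H : Finset (Finset V)} (hH : (H : Set (Finset V)).Sized d)
    (C : Set (Finset V)) : (restrict H C : Set (Finset V)).Sized d :=
  fun _ hh => hH (restrict_subset H C hh)

variable [DecidableEq V]

/-! ### Components of the clique hypergraph -/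

/-- A walk-free form of the definition. Its last clause, connectedness, mentions only `C`, so it
survives a change of the ambient `K` and transport along an embedding. -/
theorem isTwoConnComponent_iff {K C : Set (Finset V)} :
    IsTwoConnComponent K C ↔ C ⊆ K ∧ C.Nonempty ∧
      (∀ c ∈ C, ∀ c' ∈ K, 2 ≤ (c ∩ c').card → c' ∈ C) ∧
      ∀ Q ⊆ C, Q.Nonempty → (∀ c ∈ Q, ∀ c' ∈ C, 2 ≤ (c ∩ c').card → c' ∈ Q) → C ⊆ Q := by
  constructor
  · rintro ⟨c, rfl⟩
    refine ⟨?_, ?_, ?_, ?_⟩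
    · rintro _ ⟨x, -, rfl⟩
      exact x.2
    · obtain ⟨x, hx⟩ := c.nonempty_supp
      exact ⟨_, x, hx, rfl⟩
    · rintro _ ⟨x, hx, rfl⟩ c' hc' h2
      by_cases hne : x = ⟨c', hc'⟩
      · exact ⟨x, hx, by rw [hne]⟩
      · exact ⟨⟨c', hc'⟩, c.mem_supp_of_adj_mem_supp hx ⟨hne, h2⟩, rfl⟩
    · rintro Q hQ ⟨q, hq⟩ hcl _ ⟨y, hy, rfl⟩
      obtain ⟨x, hx, rfl⟩ := hQ hq
      have hr : (twoNeighborGraph K).Reachable x y := by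
        rw [SimpleGraph.ConnectedComponent.mem_supp_iff] at hx hy
        exact SimpleGraph.ConnectedComponent.exact (hx.trans hy.symm)
      obtain ⟨w⟩ := hr
      induction w with
      | nil => exact hq
      | cons hadj w ih =>
        have hv := c.mem_supp_of_adj_mem_supp hx hadj
        exact ih hy hv (hcl _ hq _ ⟨_, hv, rfl⟩ hadj.2)
  · rintro ⟨hCK, ⟨c, hc⟩, hcl, hconn⟩
    refine ⟨(twoNeighborGraph K).connectedComponentMk ⟨c, hCK hc⟩, ?_⟩
    apply Set.Subset.antisymm
    · have := hconn {x | x ∈ C ∧ ∃ h : x ∈ K, (twoNeighborGraph K).Reachable ⟨c, hCK hc⟩ ⟨x, h⟩}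
        (fun x hx => hx.1) ⟨c, hc, hCK hc, SimpleGraph.Reachable.refl _⟩ ?_
      · intro x hx
        obtain ⟨-, hK, hr⟩ := this hx
        exact ⟨⟨x, hK⟩, SimpleGraph.ConnectedComponent.sound hr.symm, rfl⟩
      · rintro x ⟨hx, hK, hr⟩ y hy h2
        refine ⟨hy, hCK hy, ?_⟩
        by_cases hxy : x = y
        · subst hxy
          exact hr
        · exact hr.trans (SimpleGraph.Adj.reachable (G := twoNeighborGraph K)
            ⟨fun h => hxy (congrArg Subtype.val h), h2⟩)
    · rintro _ ⟨y, hy, rfl⟩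
      rw [SimpleGraph.ConnectedComponent.mem_supp_iff] at hy
      obtain ⟨w⟩ := (SimpleGraph.ConnectedComponent.exact hy).symm
      suffices ∀ x y : K, (twoNeighborGraph K).Walk x y → (x : Finset V) ∈ C →
          (y : Finset V) ∈ C from this _ _ w hc
      intro x y w
      induction w with
      | nil => exact id
      | cons hadj w ih => exact fun hx => ih (hcl _ hx _ (Subtype.prop _) hadj.2)

theorem exists_isTwoConnComponent {K : Set (Finset V)} {h : Finset V} (hh : h ∈ K) :
    ∃ C, IsTwoConnComponent K C ∧ h ∈ C :=
  ⟨_, ⟨(twoNeighborGraph K).connectedComponentMk ⟨h, hh⟩, rfl⟩, ⟨h, hh⟩, rfl, rfl⟩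

/-! ### Projections and their cliques -/

theorem proj_union (H H' : Finset (Finset V)) : proj (H ∪ H') = proj H ⊔ proj H' := by
  ext u v
  simp only [proj, SimpleGraph.sup_adj, Finset.mem_union, or_and_right, exists_or, and_or_left]

theorem two_le_card_of_mem {s : Finset V} {u v : V} (huv : u ≠ v) (hu : u ∈ s) (hv : v ∈ s) :
    2 ≤ s.card := by
  rw [← Finset.card_pair huv]
  exact Finset.card_le_card (Finset.insert_subset hu (Finset.singleton_subset_iff.2 hv))

theorem subset_biUnion_of_mem_cliqueSet (hd : 2 ≤ d) {H : Finset (Finset V)} {c : Finset V}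
    (hc : c ∈ (proj H).cliqueSet d) : c ⊆ H.biUnion id := by
  obtain ⟨hcov, hcard⟩ := mem_cliqueSet_proj.1 hc
  intro u hu
  obtain ⟨v, hv, huv⟩ := exists_ne_of_two_le_card (s := c) (by omega) u
  obtain ⟨h, hh, hu', -⟩ := hcov u hu v hv huv
  exact Finset.mem_biUnion.2 ⟨h, hh, hu'⟩

theorem mem_biUnion_iff_of_sized (hd : 2 ≤ d) {H : Finset (Finset V)}
    (hH : (H : Set (Finset V)).Sized d) {u : V} :
    u ∈ H.biUnion id ↔ ∃ v, (proj H).Adj u v := by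
  constructor
  · intro hu
    obtain ⟨h, hh, hu⟩ := Finset.mem_biUnion.1 hu
    obtain ⟨v, hv, huv⟩ := exists_ne_of_two_le_card (s := h) (by rw [hH hh]; exact hd) u
    exact ⟨v, huv, h, hh, hu, hv⟩
  · rintro ⟨v, -, h, hh, hu, -⟩
    exact Finset.mem_biUnion.2 ⟨h, hh, hu⟩

theorem biUnion_eq_of_proj_eq (hd : 2 ≤ d) {H H' : Finset (Finset V)}
    (hH : (H : Set (Finset V)).Sized d) (hH' : (H' : Set (Finset V)).Sized d)
    (h : proj H = proj H') : H.biUnion id = H'.biUnion id := by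
  ext u
  rw [mem_biUnion_iff_of_sized hd hH, mem_biUnion_iff_of_sized hd hH', h]

/-! ### Restricting a hypergraph to a component -/

/-- A hyperedge covering a pair of vertices of a clique shares that pair with it, so the two lie in
the same component. Hence a clique of `C` needs only hyperedges of `C`, and those create no cliques
outside `C`. -/
theorem cliqueSet_proj_restrict (hd : 2 ≤ d) {H : Finset (Finset V)} {C : Set (Finset V)}
    (hC : IsTwoConnComponent ((proj H).cliqueSet d) C)
    (hH : (H : Set (Finset V)).Sized d) : (proj (restrict H C)).cliqueSet d = C := by
  obtain ⟨hCK, -, hcl, -⟩ := isTwoConnComponent_iff.1 hC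
  ext c
  constructor
  · intro hc
    have hcK : c ∈ (proj H).cliqueSet d :=
      SimpleGraph.cliqueSet_mono (proj_mono (restrict_subset H C)) hc
    obtain ⟨hcov, hcard⟩ := mem_cliqueSet_proj.1 hc
    obtain ⟨u, hu, v, hv, huv⟩ := Finset.one_lt_card.1 (by omega : 1 < c.card)
    obtain ⟨h, hh, hu', hv'⟩ := hcov u hu v hv huv
    exact hcl h (mem_restrict.1 hh).2 c hcK (two_le_card_of_mem huv
      (Finset.mem_inter.2 ⟨hu', hu⟩) (Finset.mem_inter.2 ⟨hv', hv⟩))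
  · intro hc
    obtain ⟨hcov, hcard⟩ := mem_cliqueSet_proj.1 (hCK hc)
    refine mem_cliqueSet_proj.2 ⟨fun u hu v hv huv => ?_, hcard⟩
    obtain ⟨h, hh, hu', hv'⟩ := hcov u hu v hv huv
    exact ⟨h, mem_restrict.2 ⟨hh, hcl c hc h (subset_cliqueSet_proj hH hh)
      (two_le_card_of_mem huv (Finset.mem_inter.2 ⟨hu, hu'⟩)
        (Finset.mem_inter.2 ⟨hv, hv'⟩))⟩, hu', hv'⟩

theorem isTwoConnComponent_self {K C : Set (Finset V)} (hC : IsTwoConnComponent K C) :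
    IsTwoConnComponent C C := by
  obtain ⟨-, hne, -, hconn⟩ := isTwoConnComponent_iff.1 hC
  exact isTwoConnComponent_iff.2 ⟨subset_rfl, hne, fun _ _ _ h _ => h, hconn⟩

/-- Exchanging the hyperedges of one component for another preimage of the same graph. -/
theorem isPreimage_sdiff_union {H R : Finset (Finset V)} {C : Set (Finset V)}
    (hH : (H : Set (Finset V)).Sized d) (hR : IsPreimage d (proj (restrict H C)) R) :
    IsPreimage d (proj H) ((H \ restrict H C) ∪ R) := by
  refine ⟨?_, ?_⟩
  · intro h hh
    rcases Finset.mem_union.1 (Finset.mem_coe.1 hh) with h1 | h1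
    · exact hH (Finset.mem_sdiff.1 h1).1
    · exact hR.1 h1
  · rw [proj_union, hR.2, ← proj_union, Finset.sdiff_union_of_subset (restrict_subset H C)]

theorem card_sdiff_union_le {H R : Finset (Finset V)} {C : Set (Finset V)} :
    ((H \ restrict H C) ∪ R).card + (restrict H C).card ≤ H.card + R.card := by
  have h1 := Finset.card_union_le (H \ restrict H C) R
  have h2 := Finset.card_sdiff_add_card_eq_card (restrict_subset H C)
  omega

/-- The restriction of a minimum preimage to a component is a minimum preimage. -/
theorem isMinPreimage_restrict {G : SimpleGraph V} {H : Finset (Finset V)} {C : Set (Finset V)}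
    (hH : IsMinPreimage d G H) : IsMinPreimage d (proj (restrict H C)) (restrict H C) := by
  obtain ⟨⟨hs, rfl⟩, hmin⟩ := hH
  refine ⟨⟨restrict_sized hs C, rfl⟩, fun R hR => ?_⟩
  have h1 := hmin _ (isPreimage_sdiff_union hs hR)
  have h2 := card_sdiff_union_le (H := H) (R := R) (C := C)
  omega

/-! ### Growth of a component -/

/-- If the `d`-set `c` meets `W` in at least two vertices, and each pair of vertices of `c` not
inside `W` is covered by `T`, then the hyperedges in `T` span few vertices outside `W`. -/
theorem card_biUnion_sdiff_le {W c : Finset V} {T : Finset (Finset V)} (hc : c.card = d)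
    (hT : ∀ t ∈ T, t.card = d ∧ 2 ≤ (t ∩ c).card) (hW : 2 ≤ (c ∩ W).card)
    (hcov : ∀ u ∈ c, ∀ v ∈ c, u ≠ v → (u ∈ W ∧ v ∈ W) ∨ ∃ t ∈ T, u ∈ t ∧ v ∈ t) :
    (d + 1) * (T.biUnion id \ W).card ≤ d * (d - 1) * T.card := by
  have hd : 2 ≤ d := by
    rw [← hc]
    exact hW.trans (Finset.card_le_card Finset.inter_subset_left)
  have h1 : (T.biUnion id \ W).card ≤ (c \ W).card + ∑ t ∈ T, (t \ c).card := by
    calc (T.biUnion id \ W).card ≤ ((c \ W) ∪ T.biUnion fun t => t \ c).card := by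
          apply Finset.card_le_card
          intro x hx
          simp only [Finset.mem_sdiff, Finset.mem_biUnion, id, Finset.mem_union] at hx ⊢
          obtain ⟨⟨t, ht, hxt⟩, hxW⟩ := hx
          by_cases hxc : x ∈ c
          · exact Or.inl ⟨hxc, hxW⟩
          · exact Or.inr ⟨t, ht, hxt, hxc⟩
      _ ≤ _ := (Finset.card_union_le _ _).trans (Nat.add_le_add_left Finset.card_biUnion_le _)
  -- Ordered pairs are counted: each pair of `c` lies in `W` or in some `t ∈ T`.
  have h2 : c.offDiag.card ≤ (c ∩ W).offDiag.card + ∑ t ∈ T, (t ∩ c).offDiag.card := by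
    calc c.offDiag.card ≤ ((c ∩ W).offDiag ∪ T.biUnion fun t => (t ∩ c).offDiag).card := by
          apply Finset.card_le_card
          rintro ⟨u, v⟩ huv
          simp only [Finset.mem_offDiag, Finset.mem_union, Finset.mem_biUnion,
            Finset.mem_inter] at huv ⊢
          obtain ⟨hu, hv, huv⟩ := huv
          rcases hcov u hu v hv huv with h | ⟨t, ht, hut, hvt⟩
          · exact Or.inl ⟨⟨hu, h.1⟩, ⟨hv, h.2⟩, huv⟩
          · exact Or.inr ⟨t, ht, ⟨hut, hu⟩, ⟨hvt, hv⟩, huv⟩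
      _ ≤ _ := (Finset.card_union_le _ _).trans (Nat.add_le_add_left Finset.card_biUnion_le _)
  -- For `j = |t ∩ c|` with `2 ≤ j ≤ d`, `d(d-1) - j(j-1) - (d+1)(d-j) = (d-j)(j-2) ≥ 0`. The
  -- constant `d + 1` is the slope of the chord between `j = 2` and `j = d`; `h4` is the same
  -- inequality for `c ∩ W`.
  have h3 : ((d + 1 : ℕ) : ℤ) * ∑ t ∈ T, ((t \ c).card : ℤ) ≤
      d * (d - 1) * T.card - ∑ t ∈ T, ((t ∩ c).offDiag.card : ℤ) := by
    rw [Finset.mul_sum, ← nsmul_eq_mul' , ← Finset.sum_const, ← Finset.sum_sub_distrib]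
    refine Finset.sum_le_sum fun t ht => ?_
    obtain ⟨htd, ht2⟩ := hT t ht
    have ha := Finset.card_sdiff_add_card_inter t c
    have hle : (t ∩ c).card ≤ d := by omega
    rw [Finset.offDiag_card]
    have hsq : (t ∩ c).card ≤ (t ∩ c).card * (t ∩ c).card := Nat.le_mul_self _
    push_cast [hsq]
    have hb : ((t \ c).card : ℤ) = d - (t ∩ c).card := by omega
    rw [hb]
    have : (0:ℤ) ≤ (d - (t ∩ c).card) * ((t ∩ c).card - 2) :=
      mul_nonneg (by omega) (by omega)
    nlinarith
  have h4 : ((d + 1 : ℕ) : ℤ) * ((c \ W).card : ℤ) ≤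
      d * (d - 1) - ((c ∩ W).offDiag.card : ℤ) := by
    have ha := Finset.card_sdiff_add_card_inter c W
    rw [Finset.offDiag_card]
    have hsq : (c ∩ W).card ≤ (c ∩ W).card * (c ∩ W).card := Nat.le_mul_self _
    push_cast [hsq]
    have hb : ((c \ W).card : ℤ) = d - (c ∩ W).card := by omega
    rw [hb]
    have : (0:ℤ) ≤ (d - (c ∩ W).card) * ((c ∩ W).card - 2) :=
      mul_nonneg (by omega) (by omega)
    nlinarith
  have h5 : (c.offDiag.card : ℤ) = d * (d - 1) := by
    rw [Finset.offDiag_card, hc]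
    have hsq : d ≤ d * d := Nat.le_mul_self _
    push_cast [hsq]
    ring
  zify at h1 h2 ⊢
  rw [Nat.cast_sub (by omega : 1 ≤ d)]
  rw [h5] at h2
  have h6 := mul_le_mul_of_nonneg_left h1 (by positivity : (0:ℤ) ≤ ((d + 1 : ℕ) : ℤ))
  push_cast at h3 h4 h6 ⊢
  linarith

/-- A clique of `proj H` which is not a clique of `proj S` is completed by few hyperedges, which
span few new vertices. -/
theorem exists_completion {S H : Finset (Finset V)} {W c : Finset V}
    (hH : (H : Set (Finset V)).Sized d) (hSW : S.biUnion id ⊆ W)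
    (hc : c ∈ (proj H).cliqueSet d) (hcS : c ∉ (proj S).cliqueSet d) (hW : 2 ≤ (c ∩ W).card) :
    ∃ T ⊆ H \ S, T.Nonempty ∧ T.card ≤ d ^ 2 ∧ (∀ t ∈ T, 2 ≤ (t ∩ c).card) ∧
      (d + 1) * (T.biUnion id \ W).card ≤ d * (d - 1) * T.card := by
  classical
  obtain ⟨hcov, hcard⟩ := mem_cliqueSet_proj.1 hc
  have hcov' : ∀ x : V × V, ∃ h, x ∈ c.offDiag → h ∈ H ∧ x.1 ∈ h ∧ x.2 ∈ h := by
    rintro ⟨u, v⟩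
    by_cases hx : (u, v) ∈ c.offDiag
    · obtain ⟨hu, hv, huv⟩ := Finset.mem_offDiag.1 hx
      obtain ⟨h, hh, hu', hv'⟩ := hcov u hu v hv huv
      exact ⟨h, fun _ => ⟨hh, hu', hv'⟩⟩
    · exact ⟨∅, fun h => absurd h hx⟩
  choose f hf using hcov'
  -- `P` consists of the pairs of `c` left uncovered by `S`. One hyperedge of `H` is chosen for
  -- each, and their set is `T`; it is nonempty because `c` is not a clique of `proj S`.
  set P := c.offDiag.filter fun x => ¬ ∃ h ∈ S, x.1 ∈ h ∧ x.2 ∈ h with hP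
  have hfP : ∀ x ∈ P, x ∈ c.offDiag ∧ (f x ∈ H ∧ x.1 ∈ f x ∧ x.2 ∈ f x) ∧ f x ∉ S := by
    intro x hx
    obtain ⟨h1, h2⟩ := Finset.mem_filter.1 hx
    exact ⟨h1, hf x h1, fun h => h2 ⟨_, h, (hf x h1).2⟩⟩
  have hmeet : ∀ t ∈ P.image f, 2 ≤ (t ∩ c).card := by
    intro t ht
    obtain ⟨x, hx, rfl⟩ := Finset.mem_image.1 ht
    obtain ⟨h1, ⟨-, h2, h3⟩, -⟩ := hfP x hx
    obtain ⟨hu, hv, huv⟩ := Finset.mem_offDiag.1 h1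
    exact two_le_card_of_mem huv (Finset.mem_inter.2 ⟨h2, hu⟩) (Finset.mem_inter.2 ⟨h3, hv⟩)
  have hsub : P.image f ⊆ H \ S := by
    intro t ht
    obtain ⟨x, hx, rfl⟩ := Finset.mem_image.1 ht
    exact Finset.mem_sdiff.2 ⟨(hfP x hx).2.1.1, (hfP x hx).2.2⟩
  refine ⟨P.image f, hsub, ?_, ?_, hmeet, ?_⟩
  · rw [Finset.image_nonempty]
    by_contra hne
    rw [Finset.not_nonempty_iff_eq_empty] at hne
    refine hcS (mem_cliqueSet_proj.2 ⟨fun u hu v hv huv => ?_, hcard⟩)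
    by_contra hcon
    have : (u, v) ∈ P := Finset.mem_filter.2 ⟨Finset.mem_offDiag.2 ⟨hu, hv, huv⟩, hcon⟩
    simp [hne] at this
  · calc (P.image f).card ≤ P.card := Finset.card_image_le
      _ ≤ c.offDiag.card := Finset.card_filter_le _ _
      _ ≤ d ^ 2 := by rw [Finset.offDiag_card, hcard, sq]; exact Nat.sub_le _ _
  · refine card_biUnion_sdiff_le hcard
      (fun t ht => ⟨hH (Finset.mem_sdiff.1 (hsub ht)).1, hmeet t ht⟩) hW ?_
    intro u hu v hv huv
    by_cases hS : ∃ h ∈ S, u ∈ h ∧ v ∈ h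
    · obtain ⟨h, hh, hu', hv'⟩ := hS
      exact Or.inl ⟨hSW (Finset.mem_biUnion.2 ⟨h, hh, hu'⟩),
        hSW (Finset.mem_biUnion.2 ⟨h, hh, hv'⟩)⟩
    · have hx : (u, v) ∈ P := Finset.mem_filter.2 ⟨Finset.mem_offDiag.2 ⟨hu, hv, huv⟩, hS⟩
      exact Or.inr ⟨f (u, v), Finset.mem_image_of_mem f hx, (hfP _ hx).2.1.2⟩

/-- A proper part of a 2-connected hypergraph can be enlarged by few hyperedges which span few
new vertices. -/
theorem exists_enlargement (hd : 2 ≤ d) {R S : Finset (Finset V)}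
    (hR : (R : Set (Finset V)).Sized d)
    (hconn : IsTwoConnComponent ((proj R).cliqueSet d) ((proj R).cliqueSet d))
    (hSR : S ⊂ R) (hS : S.Nonempty) :
    ∃ T ⊆ R \ S, T.Nonempty ∧ T.card ≤ d ^ 2 ∧
      (d + 1) * (T.biUnion id \ S.biUnion id).card ≤ d * (d - 1) * T.card := by
  obtain ⟨-, -, -, hconn⟩ := isTwoConnComponent_iff.1 hconn
  have hSs : (S : Set (Finset V)).Sized d := fun h hh => hR (hSR.1 hh)
  -- If `S` already creates all cliques, any further hyperedge lies inside its vertex set. Otherwise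
  -- connectedness yields a missing clique that shares two vertices with a clique of `S`, and
  -- completing it gives `T`.
  by_cases hall : (proj R).cliqueSet d ⊆ (proj S).cliqueSet d
  · obtain ⟨r, hr, hrS⟩ := Finset.exists_of_ssubset hSR
    refine ⟨{r}, by simp [hr, hrS], by simp, by
      rw [Finset.card_singleton]; exact Nat.one_le_pow _ _ (by omega), ?_⟩
    have : r ⊆ S.biUnion id :=
      subset_biUnion_of_mem_cliqueSet hd (hall (subset_cliqueSet_proj hR hr))
    rw [Finset.singleton_biUnion, id, Finset.sdiff_eq_empty_iff_subset.2 this]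
    simp
  · obtain ⟨s, hs⟩ := hS
    have hsub : (proj S).cliqueSet d ⊆ (proj R).cliqueSet d :=
      SimpleGraph.cliqueSet_mono (proj_mono hSR.1)
    have := mt (hconn _ hsub ⟨s, subset_cliqueSet_proj hSs hs⟩) hall
    push Not at this
    obtain ⟨c₁, hc₁, c, hc, h2, hcS⟩ := this
    obtain ⟨T, h1, h2, h3, -, h4⟩ := exists_completion hR subset_rfl hc hcS
      (h2.trans (Finset.card_le_card fun x hx => Finset.mem_inter.2
        ⟨(Finset.mem_inter.1 hx).2, subset_biUnion_of_mem_cliqueSet hd hc₁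
          (Finset.mem_inter.1 hx).1⟩))
    exact ⟨T, h1, h2, h3, h4⟩

/-- A 2-connected hypergraph contains parts of any size which span few vertices. -/
theorem exists_subset_card_biUnion_le (hd : 2 ≤ d) {R : Finset (Finset V)}
    (hR : (R : Set (Finset V)).Sized d)
    (hconn : IsTwoConnComponent ((proj R).cliqueSet d) ((proj R).cliqueSet d)) (k : ℕ) :
    ∃ S ⊆ R, S.Nonempty ∧ min k R.card ≤ S.card ∧ S.card ≤ k + d ^ 2 ∧
      (d + 1) * (S.biUnion id).card + d * (d - 1) ≤ d * (d - 1) * S.card + d * (d + 1) := by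
  induction k with
  | zero =>
    obtain ⟨-, ⟨c, hc⟩, -⟩ := isTwoConnComponent_iff.1 hconn
    obtain ⟨hcov, hcard⟩ := mem_cliqueSet_proj.1 hc
    obtain ⟨u, hu, v, hv, huv⟩ := Finset.one_lt_card.1 (by omega : 1 < c.card)
    obtain ⟨r, hr, -⟩ := hcov u hu v hv huv
    refine ⟨{r}, by simpa using hr, by simp, by simp, ?_, ?_⟩
    · rw [Finset.card_singleton]
      nlinarith
    · rw [Finset.singleton_biUnion, id, hR hr, Finset.card_singleton]
      nlinarith
  | succ k ih =>
    obtain ⟨S, hSR, hS, hmin, hle, hgrow⟩ := ih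
    -- One completion may add up to `d ^ 2` hyperedges and overshoot. The set then stays unchanged
    -- until `k` catches up, which keeps `S.card ≤ k + d ^ 2`.
    by_cases hk : min (k + 1) R.card ≤ S.card
    · exact ⟨S, hSR, hS, hk, by omega, hgrow⟩
    · have hSk : S.card ≤ k := by omega
      have hne : S ⊂ R := by
        refine hSR.ssubset_of_ne fun h => ?_
        rw [h] at hk
        omega
      obtain ⟨T, hT, hTn, hTc, hTg⟩ := exists_enlargement hd hR hconn hne hS
      have hdisj : Disjoint S T := by
        rw [Finset.disjoint_left]
        exact fun x hx hxT => (Finset.mem_sdiff.1 (hT hxT)).2 hx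
      have hcard := Finset.card_union_of_disjoint hdisj
      have hpos := hTn.card_pos
      refine ⟨S ∪ T, Finset.union_subset hSR fun x hx => (Finset.mem_sdiff.1 (hT hx)).1,
        hS.mono Finset.subset_union_left, by omega, by omega, ?_⟩
      have hun : ((S ∪ T).biUnion id).card =
          (S.biUnion id).card + (T.biUnion id \ S.biUnion id).card := by
        rw [Finset.union_biUnion, ← Finset.union_sdiff_self_eq_union,
          Finset.card_union_of_disjoint Finset.disjoint_sdiff]
      rw [hun, hcard, mul_add, mul_add]
      omega

/-- The growth bound at `k = R.card`, where the subset found must be all of `R`. -/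
theorem card_biUnion_le_of_twoConn (hd : 2 ≤ d) {R : Finset (Finset V)}
    (hR : (R : Set (Finset V)).Sized d)
    (hconn : IsTwoConnComponent ((proj R).cliqueSet d) ((proj R).cliqueSet d)) :
    (d + 1) * (R.biUnion id).card + d * (d - 1) ≤ d * (d - 1) * R.card + d * (d + 1) := by
  obtain ⟨S, hS, -, hmin, -, hle⟩ := exists_subset_card_biUnion_le hd hR hconn R.card
  rwa [Finset.eq_of_subset_of_card_le hS (by simpa using hmin)] at hle

end Combinatorics

section Transport

variable {W V : Type*} {d : ℕ}

/-! ### Copies of hypergraphs -/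

/-- The image of a hypergraph under an embedding of the vertices. -/
def copy (φ : W ↪ V) (H : Finset (Finset W)) : Finset (Finset V) :=
  H.map (Finset.mapEmbedding φ).toEmbedding

theorem mem_copy {φ : W ↪ V} {H : Finset (Finset W)} {t : Finset V} :
    t ∈ copy φ H ↔ ∃ h ∈ H, h.map φ = t := by
  simp [copy]

theorem card_copy (φ : W ↪ V) (H : Finset (Finset W)) : (copy φ H).card = H.card :=
  Finset.card_map _

theorem copy_injective (φ : W ↪ V) : Function.Injective (copy φ) :=
  Finset.map_injective _

theorem copy_sized {φ : W ↪ V} {H : Finset (Finset W)} :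
    (copy φ H : Set (Finset V)).Sized d ↔ (H : Set (Finset W)).Sized d := by
  constructor
  · intro h t ht
    rw [← h (mem_copy.2 ⟨t, ht, rfl⟩), Finset.card_map]
  · intro h t ht
    obtain ⟨s, hs, rfl⟩ := mem_copy.1 ht
    rw [Finset.card_map, h hs]

theorem proj_copy (φ : W ↪ V) (H : Finset (Finset W)) : proj (copy φ H) = (proj H).map φ := by
  ext u v
  rw [SimpleGraph.map_adj]
  constructor
  · rintro ⟨huv, t, ht, hu, hv⟩
    obtain ⟨h, hh, rfl⟩ := mem_copy.1 ht
    obtain ⟨a, ha, rfl⟩ := Finset.mem_map.1 hu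
    obtain ⟨b, hb, rfl⟩ := Finset.mem_map.1 hv
    exact ⟨a, b, ⟨fun hab => huv (by rw [hab]), h, hh, ha, hb⟩, rfl, rfl⟩
  · rintro ⟨a, b, ⟨hab, h, hh, ha, hb⟩, rfl, rfl⟩
    exact ⟨fun h => hab (φ.injective h), _, mem_copy.2 ⟨h, hh, rfl⟩,
      Finset.mem_map_of_mem φ ha, Finset.mem_map_of_mem φ hb⟩

theorem isPreimage_copy {φ : W ↪ V} {G : SimpleGraph W} {H : Finset (Finset W)} :
    IsPreimage d (G.map φ) (copy φ H) ↔ IsPreimage d G H := by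
  rw [IsPreimage, IsPreimage, copy_sized, proj_copy]
  exact and_congr_right fun _ => (SimpleGraph.map_injective φ).eq_iff

/-- As `d ≥ 2`, each vertex of a hyperedge has a neighbour in the mapped graph, so it lies in the
range of `φ`. -/
theorem exists_eq_copy (hd : 2 ≤ d) {φ : W ↪ V} {G : SimpleGraph W} {R : Finset (Finset V)}
    (hR : IsPreimage d (G.map φ) R) : ∃ H, R = copy φ H := by
  classical
  have hrange : ∀ t ∈ R, ∃ s : Finset W, s.map φ = t := by
    intro t ht
    refine ⟨t.preimage φ φ.injective.injOn, ?_⟩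
    rw [Finset.map_eq_image, Finset.image_preimage, Finset.filter_true_of_mem]
    intro u hu
    obtain ⟨v, hv, huv⟩ := exists_ne_of_two_le_card (s := t) (by rw [hR.1 ht]; exact hd) u
    have : (proj R).Adj u v := ⟨huv, t, ht, hu, hv⟩
    rw [hR.2, SimpleGraph.map_adj] at this
    obtain ⟨a, -, -, rfl, -⟩ := this
    exact ⟨a, rfl⟩
  refine ⟨R.preimage (Finset.map φ) (Finset.map_injective φ).injOn, ?_⟩
  ext t
  rw [mem_copy]
  constructor
  · intro ht
    obtain ⟨s, rfl⟩ := hrange t ht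
    exact ⟨s, Finset.mem_preimage.2 ht, rfl⟩
  · rintro ⟨s, hs, rfl⟩
    exact Finset.mem_preimage.1 hs

theorem IsMinPreimage.copy (hd : 2 ≤ d) (φ : W ↪ V) {G : SimpleGraph W} {H : Finset (Finset W)}
    (hH : IsMinPreimage d G H) :
    IsMinPreimage d (G.map φ) (HypergraphProjection.copy φ H) := by
  refine ⟨isPreimage_copy.2 hH.1, fun R hR => ?_⟩
  obtain ⟨R, rfl⟩ := exists_eq_copy hd hR
  rw [card_copy, card_copy]
  exact hH.2 R (isPreimage_copy.1 hR)

theorem IsAmbiguous.map (hd : 2 ≤ d) (φ : W ↪ V) {G : SimpleGraph W} (hG : IsAmbiguous d G) :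
    IsAmbiguous d (G.map φ) := by
  obtain ⟨H₁, H₂, hne, h₁, h₂⟩ := hG
  exact ⟨_, _, (copy_injective φ).ne hne, h₁.copy hd φ, h₂.copy hd φ⟩

variable [DecidableEq W] [DecidableEq V]

theorem biUnion_copy (φ : W ↪ V) (H : Finset (Finset W)) :
    (copy φ H).biUnion id = (H.biUnion id).map φ := by
  ext x
  simp only [Finset.mem_biUnion, mem_copy, id, Finset.mem_map]
  constructor
  · rintro ⟨_, ⟨h, hh, rfl⟩, hx⟩
    obtain ⟨a, ha, rfl⟩ := Finset.mem_map.1 hx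
    exact ⟨a, ⟨h, hh, ha⟩, rfl⟩
  · rintro ⟨a, ⟨h, hh, ha⟩, rfl⟩
    exact ⟨_, ⟨h, hh, rfl⟩, Finset.mem_map_of_mem φ ha⟩

theorem isTwoConnComponent_map (φ : W ↪ V) {K C : Set (Finset W)} :
    IsTwoConnComponent (Finset.map φ '' K) (Finset.map φ '' C) ↔ IsTwoConnComponent K C := by
  have hinter : ∀ c c' : Finset W, (c.map φ ∩ c'.map φ).card = (c ∩ c').card := fun c c' => by
    rw [← Finset.map_inter, Finset.card_map]
  have hmem : ∀ {c : Finset W} {A : Set (Finset W)}, c.map φ ∈ Finset.map φ '' A ↔ c ∈ A :=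
    (Finset.map_injective φ).mem_set_image
  rw [isTwoConnComponent_iff, isTwoConnComponent_iff,
    Set.image_subset_image_iff (Finset.map_injective φ), Set.image_nonempty]
  refine and_congr_right fun _ => and_congr_right fun _ => and_congr ?_ ?_
  · simp only [Set.forall_mem_image, hinter, hmem]
  · constructor
    · intro h Q hQ hne hcl
      have := h (Finset.map φ '' Q) (Set.image_mono hQ) (hne.image _)
        (by simpa only [Set.forall_mem_image, hinter, hmem] using hcl)
      exact (Set.image_subset_image_iff (Finset.map_injective φ)).1 this
    · intro h Q hQ hne hcl
      obtain ⟨Q, hQ', rfl⟩ := Set.subset_image_iff.1 hQ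
      simp only [Set.forall_mem_image, hinter, hmem] at hcl
      exact Set.image_mono (h Q hQ' hne.of_image hcl)

end Transport

/-! ### Sparse hypergraphs -/

/-- Every set of at most `L` hyperedges of `H` spans at least `β` vertices per hyperedge. -/
def SpansUpTo {V : Type*} [DecidableEq V] (β : ℝ) (L : ℕ) (H : Finset (Finset V)) : Prop :=
  ∀ S ⊆ H, S.card ≤ L → β * S.card ≤ (S.biUnion id).card

/-- Every set of hyperedges of `H` spans at least `β` vertices per hyperedge. -/
def Spans {V : Type*} [DecidableEq V] (β : ℝ) (H : Finset (Finset V)) : Prop :=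
  ∀ S ⊆ H, β * S.card ≤ (S.biUnion id).card

/-- The hyperedges of an ambiguous 2-connected component which may appear in the random
hypergraph. -/
structure IsObstruction {V : Type*} [DecidableEq V] (d : ℕ) (β : ℝ) (R : Finset (Finset V)) :
    Prop where
  sized : (R : Set (Finset V)).Sized d
  ambiguous : IsAmbiguous d (proj R)
  conn : IsTwoConnComponent ((proj R).cliqueSet d) ((proj R).cliqueSet d)
  spans : Spans β R

theorem IsObstruction.copy {W V : Type*} [DecidableEq W] [DecidableEq V] {d : ℕ} (hd : 2 ≤ d)
    {β : ℝ} {R : Finset (Finset W)} (hR : IsObstruction d β R) (φ : W ↪ V) :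
    IsObstruction d β (HypergraphProjection.copy φ R) where
  sized := copy_sized.2 hR.sized
  ambiguous := by
    rw [proj_copy]
    exact hR.ambiguous.map hd φ
  conn := by
    rw [proj_copy, SimpleGraph.cliqueSet_map (by omega), isTwoConnComponent_map]
    exact hR.conn
  spans := by
    intro S hS
    obtain ⟨S, hS', rfl⟩ := Finset.subset_map_iff.1 hS
    have := hR.spans S hS'
    rw [show S.map (Finset.mapEmbedding φ).toEmbedding = HypergraphProjection.copy φ S from rfl,
      card_copy, biUnion_copy, Finset.card_map]
    exact this

/-- A hypergraph whose small parts are sparse is the only minimum preimage of its projection,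
unless it contains an obstruction. -/
theorem exists_isObstruction {d : ℕ} (hd : 3 ≤ d) {β : ℝ} (hβ : d * (d - 1) < (d + 1) * β) :
    ∃ L : ℕ, ∀ {V : Type} [DecidableEq V] (H H₀ : Finset (Finset V)),
      (H : Set (Finset V)).Sized d → SpansUpTo β L H → IsMinPreimage d (proj H) H₀ → H₀ ≠ H →
      ∃ R : Finset (Finset V), IsObstruction d β R := by
  -- `k` is the size from which the growth bound contradicts density `β`: a part with at least `k`
  -- hyperedges has a deficit above the additive slack, which is at most `d(d+1)`.
  obtain ⟨k, hk⟩ := exists_nat_gt (d * (d + 1) / ((d + 1) * β - d * (d - 1)))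
  rw [div_lt_iff₀ (by linarith)] at hk
  refine ⟨k + d ^ 2, fun {V} _ H H₀ hH hspan hmin hne => ?_⟩
  have hd2 : 2 ≤ d := by omega
  have hdR : (3 : ℝ) ≤ d := by exact_mod_cast hd
  have hcast : ((d - 1 : ℕ) : ℝ) = d - 1 := by rw [Nat.cast_sub (by omega)]; simp
  have hcl : (H₀ : Set (Finset V)) ⊆ (proj H).cliqueSet d := by
    have := subset_cliqueSet_proj hmin.1.1
    rwa [hmin.1.2] at this
  -- Every hyperedge of either preimage is a clique of `proj H`, so two distinct preimages differ on
  -- some component.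
  obtain ⟨C, hC, hCne⟩ : ∃ C, IsTwoConnComponent ((proj H).cliqueSet d) C ∧
      restrict H₀ C ≠ restrict H C := by
    by_contra! hcon
    refine hne (Finset.ext fun h => ?_)
    by_cases hh : h ∈ (proj H).cliqueSet d
    · obtain ⟨C, hC, hhC⟩ := exists_isTwoConnComponent hh
      have := Finset.ext_iff.1 (hcon C hC) h
      simpa [mem_restrict, hhC] using this
    · exact ⟨fun h' => absurd (hcl h') hh, fun h' => absurd (subset_cliqueSet_proj hH h') hh⟩
  have hR := restrict_sized hH C
  have hR₀ := restrict_sized hmin.1.1 C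
  have hcR := cliqueSet_proj_restrict hd2 hC hH
  have hcR₀ : (proj (restrict H₀ C)).cliqueSet d = C :=
    cliqueSet_proj_restrict hd2 (by rw [hmin.1.2]; exact hC) hmin.1.1
  have hproj := proj_eq_of_cliqueSet_eq hR hR₀ (hcR.trans hcR₀.symm)
  have hconn : IsTwoConnComponent ((proj (restrict H C)).cliqueSet d)
      ((proj (restrict H C)).cliqueSet d) := by
    rw [hcR]
    exact isTwoConnComponent_self hC
  have hmin₀ := isMinPreimage_restrict (C := C) hmin
  -- Otherwise `C` would contain a part with between `k` and `k + d ^ 2` hyperedges, small enough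
  -- for `hspan` but spanning too few vertices.
  have hsmall : (restrict H C).card < k := by
    by_contra! hbig
    obtain ⟨S, hSR, -, h1, h2, h3⟩ := exists_subset_card_biUnion_le hd2 hR hconn k
    have h4 := hspan S (hSR.trans (restrict_subset H C)) h2
    have h5 : (k : ℝ) ≤ S.card := by
      rw [min_eq_left hbig] at h1
      exact_mod_cast h1
    have h6 : ((d : ℝ) + 1) * (S.biUnion id).card + d * (d - 1) ≤
        d * (d - 1) * S.card + d * (d + 1) := by
      rw [← hcast]
      exact_mod_cast h3
    have h7 := mul_le_mul_of_nonneg_right h5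
      (by linarith : 0 ≤ (d + 1) * β - d * ((d : ℝ) - 1))
    have h8 := mul_le_mul_of_nonneg_left h4 (by linarith : (0 : ℝ) ≤ d + 1)
    nlinarith
  have hspans : Spans β (restrict H C) := fun S hS =>
    hspan S (hS.trans (restrict_subset H C)) ((Finset.card_le_card hS).trans (by omega))
  -- Suppose `restrict H₀ C` were smaller. It spans the same vertices, so its growth bound against
  -- the density of `restrict H C` would give `d(d-1) < 2d`, which is false for `d ≥ 3`.
  have hle : (restrict H C).card ≤ (restrict H₀ C).card := by
    by_contra! hlt
    have h1 := card_biUnion_le_of_twoConn hd2 hR₀ (by rwa [← hproj])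
    rw [← biUnion_eq_of_proj_eq hd2 hR hR₀ hproj] at h1
    have h2 := hspans _ subset_rfl
    have h3 : ((restrict H₀ C).card : ℝ) + 1 ≤ (restrict H C).card := by exact_mod_cast hlt
    have h4 : ((d : ℝ) + 1) * ((restrict H C).biUnion id).card + d * (d - 1) ≤
        d * (d - 1) * (restrict H₀ C).card + d * (d + 1) := by
      rw [← hcast]
      exact_mod_cast h1
    have h5 := mul_le_mul_of_nonneg_left h2 (by linarith : (0 : ℝ) ≤ d + 1)
    have h6 : (1 : ℝ) ≤ (restrict H C).card := by
      have : (0 : ℝ) ≤ (restrict H₀ C).card := Nat.cast_nonneg _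
      linarith
    have h7 := mul_le_mul_of_nonneg_right h6
      (by linarith : 0 ≤ (d + 1) * β - d * ((d : ℝ) - 1))
    have h8 := mul_le_mul_of_nonneg_left h3 (by nlinarith : 0 ≤ d * ((d : ℝ) - 1))
    nlinarith
  refine ⟨restrict H C, hR, ⟨restrict H₀ C, restrict H C, hCne, ?_, ?_⟩, hconn, hspans⟩
  · rwa [hproj]
  · refine ⟨⟨hR, rfl⟩, fun R' hR' => hle.trans (hmin₀.2 R' ?_)⟩
    rwa [← hproj]

/-- The hyperedges of a component with an ambiguous graph project to that graph. -/
theorem proj_restrict_eq {W V : Type*} [DecidableEq V] {d : ℕ} (hd : 2 ≤ d)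
    {Ga : SimpleGraph W} (hGa : IsAmbiguous d Ga) {H : Finset (Finset V)}
    (hH : (H : Set (Finset V)).Sized d) {φ : W ↪ V}
    (hC : IsTwoConnComponent ((proj H).cliqueSet d) ((Ga.map φ).cliqueSet d)) :
    proj (restrict H ((Ga.map φ).cliqueSet d)) = Ga.map φ := by
  -- Ambiguity serves only to write the mapped graph as a projection, so that it is determined by
  -- its `d`-cliques.
  obtain ⟨H₁, -, -, h₁, -⟩ := hGa.map hd φ
  rw [← h₁.1.2] at hC ⊢
  exact proj_eq_of_cliqueSet_eq (restrict_sized hH _) h₁.1.1 (cliqueSet_proj_restrict hd hC hH)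

/-- If an ambiguous graph appears as a component of `proj H₀`, then some other preimage has at
most as many hyperedges as `H₀`. -/
theorem exists_ne_card_le {W V : Type*} [DecidableEq V] {d : ℕ} (hd : 2 ≤ d)
    {Ga : SimpleGraph W} (hGa : IsAmbiguous d Ga) {H₀ : Finset (Finset V)}
    (hH₀ : (H₀ : Set (Finset V)).Sized d) (happ : AppearsAsComponent d Ga (proj H₀)) :
    ∃ H, H ≠ H₀ ∧ IsPreimage d (proj H₀) H ∧ H.card ≤ H₀.card := by
  obtain ⟨φ, hC⟩ := happ
  set C := (Ga.map φ).cliqueSet d with hCdef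
  obtain ⟨H₁, H₂, hne, h₁, h₂⟩ := hGa.map hd φ
  have hproj : proj (restrict H₀ C) = Ga.map φ := proj_restrict_eq hd hGa hH₀ hC
  -- Of two distinct minimum preimages, at least one differs from what `H₀` has on the component.
  obtain ⟨R, hR, hRne⟩ : ∃ R, IsMinPreimage d (Ga.map φ) R ∧ R ≠ restrict H₀ C := by
    by_cases h : H₁ = restrict H₀ C
    · exact ⟨H₂, h₂, fun h' => hne (h.trans h'.symm)⟩
    · exact ⟨H₁, h₁, h⟩
  refine ⟨(H₀ \ restrict H₀ C) ∪ R, fun heq => hRne ?_,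
    isPreimage_sdiff_union hH₀ (by rw [hproj]; exact hR.1), ?_⟩
  · have hRC : ∀ t ∈ R, t ∈ C := fun t ht => by
      have := subset_cliqueSet_proj hR.1.1 ht
      rwa [hR.1.2] at this
    ext t
    have ht := Finset.ext_iff.1 heq t
    simp only [Finset.mem_union, Finset.mem_sdiff, mem_restrict] at ht ⊢
    have := hRC t
    tauto
  · have h3 := card_sdiff_union_le (H := H₀) (R := R) (C := C)
    have h4 := hR.2 _ ⟨restrict_sized hH₀ C, hproj⟩
    omega

/-! ### An ambiguous graph

Two `d`-sets `core b` share all but one of their vertices; each pair of a `core b` which is not in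
the other one is also contained in a hyperedge `leg b i`. -/

section Gadget

variable {e : ℕ}

/-- The vertices: two hubs, `e + 1` common vertices of the cores, and `e` private vertices for
each leg. -/
abbrev GadgetVertex (e : ℕ) : Type := Bool ⊕ (Fin (e + 1) ⊕ (Bool × Fin (e + 1) × Fin e))

/-- The leg at the hub `x.1` and the common vertex `x.2`. -/
def leg (x : Bool × Fin (e + 1)) : Finset (GadgetVertex e) :=
  Finset.disjSum {x.1} (Finset.disjSum {x.2} ({x.1} ×ˢ ({x.2} ×ˢ Finset.univ)))

/-- The core at the hub `b`. -/
def core (b : Bool) : Finset (GadgetVertex e) :=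
  Finset.disjSum {b} (Finset.disjSum Finset.univ ∅)

/-- All legs. -/
def legs (e : ℕ) : Finset (Finset (GadgetVertex e)) :=
  Finset.univ.image leg

/-- All legs and one of the two cores. -/
def gadget (e : ℕ) (b : Bool) : Finset (Finset (GadgetVertex e)) :=
  insert (core b) (legs e)

theorem mem_legs {t : Finset (GadgetVertex e)} : t ∈ legs e ↔ ∃ x, leg x = t := by
  simp [legs]

theorem mem_gadget {b : Bool} {t : Finset (GadgetVertex e)} :
    t ∈ gadget e b ↔ t = core b ∨ ∃ x, leg x = t := by
  rw [gadget, Finset.mem_insert, mem_legs]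

@[simp] theorem inl_mem_leg {x : Bool × Fin (e + 1)} {b : Bool} :
    (Sum.inl b : GadgetVertex e) ∈ leg x ↔ b = x.1 := by
  simp [leg]

@[simp] theorem inr_inl_mem_leg {x : Bool × Fin (e + 1)} {i : Fin (e + 1)} :
    (Sum.inr (Sum.inl i) : GadgetVertex e) ∈ leg x ↔ i = x.2 := by
  simp [leg]

@[simp] theorem inr_inr_mem_leg {x : Bool × Fin (e + 1)} {y : Bool × Fin (e + 1) × Fin e} :
    (Sum.inr (Sum.inr y) : GadgetVertex e) ∈ leg x ↔ y.1 = x.1 ∧ y.2.1 = x.2 := by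
  obtain ⟨b, i, k⟩ := y
  simp [leg, Prod.ext_iff, eq_comm]

@[simp] theorem inl_mem_core {b b' : Bool} :
    (Sum.inl b : GadgetVertex e) ∈ core b' ↔ b = b' := by
  simp [core]

@[simp] theorem inr_inl_mem_core {b : Bool} {i : Fin (e + 1)} :
    (Sum.inr (Sum.inl i) : GadgetVertex e) ∈ core b := by
  simp [core]

@[simp] theorem inr_inr_notMem_core {b : Bool} {y : Bool × Fin (e + 1) × Fin e} :
    (Sum.inr (Sum.inr y) : GadgetVertex e) ∉ core b := by
  simp [core]

theorem card_leg (x : Bool × Fin (e + 1)) : (leg x).card = e + 2 := by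
  simp [leg, Finset.card_disjSum]
  omega

theorem card_core (b : Bool) : (core b : Finset (GadgetVertex e)).card = e + 2 := by
  simp [core, Finset.card_disjSum]
  omega

theorem gadget_sized (b : Bool) :
    (gadget e b : Set (Finset (GadgetVertex e))).Sized (e + 2) := by
  intro t ht
  rcases mem_gadget.1 ht with rfl | ⟨x, rfl⟩
  · exact card_core b
  · exact card_leg x

theorem core_injective : Function.Injective (core : Bool → Finset (GadgetVertex e)) := by
  intro b b' h
  exact inl_mem_core.1 (h ▸ inl_mem_core.2 rfl)

theorem leg_ne_core (he : 1 ≤ e) (x : Bool × Fin (e + 1)) (b : Bool) : leg x ≠ core b := by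
  intro h
  have : (Sum.inr (Sum.inr (x.1, x.2, ⟨0, he⟩)) : GadgetVertex e) ∈ core b :=
    h ▸ inr_inr_mem_leg.2 ⟨rfl, rfl⟩
  exact inr_inr_notMem_core this

theorem card_gadget (he : 1 ≤ e) (b : Bool) : (gadget e b).card = (legs e).card + 1 := by
  refine Finset.card_insert_of_notMem fun h => ?_
  obtain ⟨x, hx⟩ := mem_legs.1 h
  exact leg_ne_core he x b hx

/-- All neighbours of a private vertex lie in its leg, so a clique with a private vertex is that
leg. Any other clique has at most one hub, since the hubs are not adjacent, and so fills a core. The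
answer does not depend on `b`: the legs cover all pairs at both hubs, and either core covers the
common vertices. -/
theorem mem_cliqueSet_gadget {b : Bool} {c : Finset (GadgetVertex e)} :
    c ∈ (proj (gadget e b)).cliqueSet (e + 2) ↔ (∃ x, leg x = c) ∨ ∃ b', core b' = c := by
  constructor
  · intro hc
    obtain ⟨hcov, hcard⟩ := mem_cliqueSet_proj.1 hc
    by_cases hp : ∃ y, (Sum.inr (Sum.inr y) : GadgetVertex e) ∈ c
    · obtain ⟨y, hy⟩ := hp
      refine Or.inl ⟨(y.1, y.2.1), (Finset.eq_of_subset_of_card_le ?_ ?_).symm⟩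
      · intro v hv
        by_cases hvy : Sum.inr (Sum.inr y) = v
        · rw [← hvy]
          simp
        · obtain ⟨t, ht, hyt, hvt⟩ := hcov _ hy v hv hvy
          rcases mem_gadget.1 ht with rfl | ⟨x, rfl⟩
          · exact absurd hyt inr_inr_notMem_core
          · obtain ⟨h1, h2⟩ := inr_inr_mem_leg.1 hyt
            rw [h1, h2]
            exact hvt
      · rw [card_leg, hcard]
    · have hcore : ∀ b', Sum.inl (!b') ∉ c → core b' = c := fun b' hb' => by
        refine (Finset.eq_of_subset_of_card_le ?_ (by rw [card_core, hcard])).symm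
        rintro (b'' | i | y) hv
        · rw [inl_mem_core]
          by_contra hne
          rw [Bool.eq_not_of_ne hne] at hv
          exact hb' hv
        · simp
        · exact absurd ⟨y, hv⟩ hp
      by_cases ht : Sum.inl true ∈ c
      · refine Or.inr ⟨true, hcore true fun hf => ?_⟩
        obtain ⟨t, ht, h1, h2⟩ := hcov _ ht _ hf (by simp)
        rcases mem_gadget.1 ht with rfl | ⟨x, rfl⟩
        · rw [inl_mem_core] at h1 h2
          simp [← h1] at h2
        · rw [inl_mem_leg] at h1 h2
          simp [← h1] at h2
      · exact Or.inr ⟨false, hcore false ht⟩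
  · rintro (⟨x, rfl⟩ | ⟨b', rfl⟩)
    · exact subset_cliqueSet_proj (gadget_sized b) (mem_gadget.2 (Or.inr ⟨x, rfl⟩))
    · refine mem_cliqueSet_proj.2 ⟨?_, card_core b'⟩
      have hz : ∀ i, ∃ h ∈ gadget e b, (Sum.inl b' : GadgetVertex e) ∈ h ∧
          Sum.inr (Sum.inl i) ∈ h := fun i =>
        ⟨leg (b', i), mem_gadget.2 (Or.inr ⟨_, rfl⟩), by simp, by simp⟩
      rintro (b₁ | i | y) hu (b₂ | j | y') hv huv
      · rw [inl_mem_core] at hu hv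
        exact absurd (by rw [hu, hv]) huv
      · rw [inl_mem_core] at hu
        rw [hu]
        exact hz j
      · exact absurd hv inr_inr_notMem_core
      · rw [inl_mem_core] at hv
        obtain ⟨h, hh, h1, h2⟩ := hz i
        rw [hv]
        exact ⟨h, hh, h2, h1⟩
      · exact ⟨core b, mem_gadget.2 (Or.inl rfl), by simp, by simp⟩
      · exact absurd hv inr_inr_notMem_core
      all_goals exact absurd hu inr_inr_notMem_core

theorem proj_gadget (b b' : Bool) : proj (gadget e b) = proj (gadget e b') := by
  refine proj_eq_of_cliqueSet_eq (gadget_sized b) (gadget_sized b') ?_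
  ext c
  rw [mem_cliqueSet_gadget, mem_cliqueSet_gadget]

/-- Private vertices force every leg into a preimage, and two distinct common vertices are joined
only by a core. So each preimage contains all legs and at least one core. -/
theorem isMinPreimage_gadget (he : 1 ≤ e) (b b' : Bool) :
    IsMinPreimage (e + 2) (proj (gadget e b)) (gadget e b') := by
  refine ⟨⟨gadget_sized b', proj_gadget b' b⟩, fun R hR => ?_⟩
  have hcl : ∀ t ∈ R, (∃ x, leg x = t) ∨ ∃ b', core b' = t := fun t ht => by
    have := subset_cliqueSet_proj hR.1 ht
    rwa [hR.2, mem_cliqueSet_gadget] at this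
  have hlegs : ∀ x, leg x ∈ R := by
    intro x
    have hadj : (proj (gadget e b)).Adj (Sum.inl x.1) (Sum.inr (Sum.inr (x.1, x.2, ⟨0, he⟩))) :=
      ⟨by simp, leg x, mem_gadget.2 (Or.inr ⟨x, rfl⟩), by simp, by simp⟩
    rw [← hR.2] at hadj
    obtain ⟨-, t, ht, -, h⟩ := hadj
    rcases hcl t ht with ⟨x', rfl⟩ | ⟨b', rfl⟩
    · obtain ⟨h1, h2⟩ := inr_inr_mem_leg.1 h
      rwa [show x = x' from Prod.ext h1 h2]
    · exact absurd h inr_inr_notMem_core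
  obtain ⟨b'', hb''⟩ : ∃ b', core b' ∈ R := by
    have hadj : (proj (gadget e b)).Adj (Sum.inr (Sum.inl 0)) (Sum.inr (Sum.inl (Fin.last e))) :=
      ⟨by simp [Fin.ext_iff]; omega, core b, mem_gadget.2 (Or.inl rfl), by simp, by simp⟩
    rw [← hR.2] at hadj
    obtain ⟨-, t, ht, h1, h2⟩ := hadj
    rcases hcl t ht with ⟨x', rfl⟩ | ⟨b', rfl⟩
    · rw [inr_inl_mem_leg] at h1 h2
      have := congrArg Fin.val (h1.trans h2.symm)
      simp at this
      omega
    · exact ⟨b', ht⟩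
  rw [card_gadget he b', ← card_gadget he b'']
  refine Finset.card_le_card fun t ht => ?_
  rcases mem_gadget.1 ht with rfl | ⟨x, rfl⟩
  · exact hb''
  · exact hlegs x

theorem isAmbiguous_gadget (he : 1 ≤ e) (b : Bool) :
    IsAmbiguous (e + 2) (proj (gadget e b)) := by
  refine ⟨gadget e true, gadget e false, fun h => ?_, isMinPreimage_gadget he b true,
    isMinPreimage_gadget he b false⟩
  have : core true ∈ gadget e false := h ▸ mem_gadget.2 (Or.inl rfl)
  rcases mem_gadget.1 this with h | ⟨x, hx⟩
  · exact absurd (core_injective h) (by simp)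
  · exact leg_ne_core he x true hx

theorem isTwoConnComponent_gadget (he : 1 ≤ e) (b : Bool) :
    IsTwoConnComponent ((proj (gadget e b)).cliqueSet (e + 2))
      ((proj (gadget e b)).cliqueSet (e + 2)) := by
  refine isTwoConnComponent_iff.2 ⟨subset_rfl, ⟨core b, mem_cliqueSet_gadget.2 (Or.inr ⟨b, rfl⟩)⟩,
    fun _ _ _ h _ => h, fun Q hQ ⟨q, hq⟩ hcl => ?_⟩
  have hcc : ∀ b₁ b₂ : Bool, 2 ≤ (core b₁ ∩ core b₂ : Finset (GadgetVertex e)).card :=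
    fun b₁ b₂ => two_le_card_of_mem (u := Sum.inr (Sum.inl 0))
      (v := Sum.inr (Sum.inl (Fin.last e))) (by simp [Fin.ext_iff]; omega) (by simp) (by simp)
  have hlc : ∀ x, 2 ≤ (leg x ∩ core x.1 : Finset (GadgetVertex e)).card :=
    fun x => two_le_card_of_mem (u := Sum.inl x.1)
      (v := Sum.inr (Sum.inl x.2)) (by simp) (by simp) (by simp)
  have hcm : ∀ b', core b' ∈ (proj (gadget e b)).cliqueSet (e + 2) := fun b' =>
    mem_cliqueSet_gadget.2 (Or.inr ⟨b', rfl⟩)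
  obtain ⟨b₀, hb₀⟩ : ∃ b', core b' ∈ Q := by
    rcases mem_cliqueSet_gadget.1 (hQ hq) with ⟨x, rfl⟩ | ⟨b', rfl⟩
    · exact ⟨x.1, hcl _ hq _ (hcm _) (hlc x)⟩
    · exact ⟨b', hq⟩
  have hcore : ∀ b', core b' ∈ Q := fun b' => hcl _ hb₀ _ (hcm _) (hcc _ _)
  intro c hc
  rcases mem_cliqueSet_gadget.1 hc with ⟨x, rfl⟩ | ⟨b', rfl⟩
  · exact hcl _ (hcore x.1) _ hc (by rw [Finset.inter_comm]; exact hlc x)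
  · exact hcore b'

/-- This says that the gadget has density `d(d-1)/(d+1)` with `d = e + 2`. It is the only place
where `d ≤ 5` matters: the whole gadget has `2d - 1` hyperedges on `2d² - 5d + 5` vertices, and the
inequality for it reduces to `d ≤ 5`. -/
theorem spans_gadget (he : 1 ≤ e) (he3 : e ≤ 3) {S : Finset (Finset (GadgetVertex e))}
    (hS : S ⊆ gadget e true) :
    (e + 2) * (e + 1) * S.card ≤ (e + 3) * (S.biUnion id).card := by
  classical
  set I : Finset (Bool × Fin (e + 1)) := Finset.univ.filter fun x => leg x ∈ S with hI
  have hmemI : ∀ {x}, x ∈ I ↔ leg x ∈ S := by simp [hI]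
  have hpriv : ((I ×ˢ (Finset.univ : Finset (Fin e))).map
      (Equiv.prodAssoc Bool (Fin (e + 1)) (Fin e)).toEmbedding).card = I.card * e := by
    simp
  set P := (I ×ˢ (Finset.univ : Finset (Fin e))).map
      (Equiv.prodAssoc Bool (Fin (e + 1)) (Fin e)).toEmbedding with hP
  have hmemP : ∀ {y}, y ∈ P → leg (y.1, y.2.1) ∈ S := by
    intro y hy
    obtain ⟨⟨x, k⟩, hx, rfl⟩ := Finset.mem_map.1 hy
    exact hmemI.1 (Finset.mem_product.1 hx).1
  by_cases hc : core true ∈ S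
  · have hScard : S.card ≤ I.card + 1 := by
      have : S ⊆ insert (core true) (I.image leg) := fun t ht => by
        rcases mem_gadget.1 (hS ht) with rfl | ⟨x, rfl⟩
        · simp
        · exact Finset.mem_insert_of_mem (Finset.mem_image_of_mem _ (hmemI.2 ht))
      exact (Finset.card_le_card this).trans ((Finset.card_insert_le _ _).trans
        (Nat.add_le_add_right Finset.card_image_le 1))
    have hsub : Finset.disjSum (insert true (I.image Prod.fst)) (Finset.disjSum Finset.univ P) ⊆
        S.biUnion id := by
      rintro (b | i | y) hv
      · rw [Finset.inl_mem_disjSum, Finset.mem_insert, Finset.mem_image] at hv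
        rcases hv with rfl | ⟨x, hx, rfl⟩
        · exact Finset.mem_biUnion.2 ⟨_, hc, by simp⟩
        · exact Finset.mem_biUnion.2 ⟨_, hmemI.1 hx, by simp⟩
      · exact Finset.mem_biUnion.2 ⟨_, hc, by simp⟩
      · simp only [Finset.inr_mem_disjSum] at hv
        exact Finset.mem_biUnion.2 ⟨_, hmemP hv, by simp⟩
    have h1 := Finset.card_le_card hsub
    rw [Finset.card_disjSum, Finset.card_disjSum, hpriv, Finset.card_univ, Fintype.card_fin] at h1
    -- A leg costs `(e+2)(e+1)` and its private vertices return `(e+3)e`, leaving `2` to be paid by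
    -- hubs and common vertices. With both hubs and all `2(e+1)` legs this is `(e+3)² ≥ 4(e+1) +
    -- (e+2)(e+1)`, i.e. `e ≤ 3`.
    have h2 : (e + 3) * ((insert true (I.image Prod.fst)).card + (e + 1)) ≥
        2 * I.card + (e + 2) * (e + 1) := by
      by_cases hf : ∃ x ∈ I, x.1 = false
      · obtain ⟨x, hx, hxf⟩ := hf
        have hA : 2 ≤ (insert true (I.image Prod.fst)).card :=
          two_le_card_of_mem (u := true) (v := false) (by simp) (by simp)
            (Finset.mem_insert_of_mem (Finset.mem_image.2 ⟨x, hx, hxf⟩))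
        have hIc : I.card ≤ 2 * (e + 1) := by
          have := Finset.card_le_univ I
          simpa using this
        nlinarith
      · have hA : 1 ≤ (insert true (I.image Prod.fst)).card :=
          Finset.card_pos.2 ⟨true, by simp⟩
        have hIc : I.card ≤ e + 1 := by
          have : I ⊆ {true} ×ˢ Finset.univ := fun x hx => by
            have : x.1 = true := by
              by_contra h
              exact hf ⟨x, hx, by simpa using h⟩
            exact Finset.mem_product.2 ⟨Finset.mem_singleton.2 this, Finset.mem_univ _⟩
          simpa using Finset.card_le_card this
        nlinarith
    have h3 := Nat.mul_le_mul_left (e + 3) h1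
    have h4 := Nat.mul_le_mul_left ((e + 2) * (e + 1)) hScard
    linarith
  · have hScard : S.card ≤ I.card := by
      have : S ⊆ I.image leg := fun t ht => by
        rcases mem_gadget.1 (hS ht) with rfl | ⟨x, rfl⟩
        · exact absurd ht hc
        · exact Finset.mem_image_of_mem _ (hmemI.2 ht)
      exact (Finset.card_le_card this).trans Finset.card_image_le
    have hsub : Finset.disjSum ∅ (Finset.disjSum (I.image Prod.snd) P) ⊆ S.biUnion id := by
      rintro (b | i | y) hv
      · simp at hv
      · rw [Finset.inr_mem_disjSum, Finset.inl_mem_disjSum, Finset.mem_image] at hv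
        obtain ⟨x, hx, rfl⟩ := hv
        exact Finset.mem_biUnion.2 ⟨_, hmemI.1 hx, by simp⟩
      · simp only [Finset.inr_mem_disjSum] at hv
        exact Finset.mem_biUnion.2 ⟨_, hmemP hv, by simp⟩
    have h1 := Finset.card_le_card hsub
    rw [Finset.card_disjSum, Finset.card_disjSum, hpriv, Finset.card_empty] at h1
    -- Each common vertex lies in at most two legs, one for each hub. Without the core, the common
    -- vertices alone pay the deficit `2` per leg.
    have hIc : I.card ≤ 2 * (I.image Prod.snd).card := by
      have : I ⊆ Finset.univ ×ˢ I.image Prod.snd := fun x hx =>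
        Finset.mem_product.2 ⟨Finset.mem_univ _, Finset.mem_image_of_mem _ hx⟩
      simpa using Finset.card_le_card this
    have h3 := Nat.mul_le_mul_left (e + 3) h1
    have h4 := Nat.mul_le_mul_left ((e + 2) * (e + 1)) hScard
    have h5 := Nat.mul_le_mul_right (I.image Prod.snd).card (by omega : 4 ≤ e + 3)
    linarith

end Gadget

theorem exists_isObstruction_critical {d : ℕ} (hd : 3 ≤ d) (hd5 : d ≤ 5) :
    ∃ (m : ℕ) (R : Finset (Finset (Fin m))),
      IsObstruction d ((d : ℝ) * (d - 1) / (d + 1)) R := by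
  obtain ⟨e, rfl⟩ : ∃ e, d = e + 2 := ⟨d - 2, by omega⟩
  have he : 1 ≤ e := by omega
  refine ⟨_, _, IsObstruction.copy (by omega) (R := gadget e true) ⟨gadget_sized true,
    isAmbiguous_gadget he true, isTwoConnComponent_gadget he true, fun S hS => ?_⟩
    (Fintype.equivFin (GadgetVertex e)).toEmbedding⟩
  have h : ((e : ℝ) + 2) * (e + 1) * S.card ≤ (e + 3) * (S.biUnion id).card := by
    exact_mod_cast spans_gadget he (by omega) hS
  rw [div_mul_eq_mul_div, div_le_iff₀ (by positivity)]
  push_cast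
  linarith

section RandomSubset

/-! ### Random subsets -/

variable {α : Type*} {R : Finset α} {p : ℝ} {E F : Finset α → Prop}

/-- The probability that a random subset of `R`, containing each element independently with
probability `p`, is `H`. -/
def weight (R : Finset α) (p : ℝ) (H : Finset α) : ℝ :=
  p ^ H.card * (1 - p) ^ (R.card - H.card)

open Classical in
/-- The probability that a random subset of `R`, containing each element independently with
probability `p`, has property `E`. -/
noncomputable def subsetProb (R : Finset α) (p : ℝ) (E : Finset α → Prop) : ℝ :=
  ∑ H ∈ R.powerset with E H, weight R p H

theorem prob_eq_subsetProb (n d : ℕ) (p : ℝ) (E : Finset (Finset (Fin n)) → Prop) :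
    prob n d p E = subsetProb (allHyperedges n d) p E := by
  simp [prob, subsetProb, weight, allHyperedges]

theorem weight_nonneg (hp : 0 ≤ p) (hp1 : p ≤ 1) (H : Finset α) : 0 ≤ weight R p H :=
  mul_nonneg (pow_nonneg hp _) (pow_nonneg (by linarith) _)

theorem sum_weight (R : Finset α) (p : ℝ) : ∑ H ∈ R.powerset, weight R p H = 1 := by
  simp only [weight, Finset.sum_pow_mul_eq_add_pow, add_sub_cancel, one_pow]

open Classical in
theorem subsetProb_eq_sum_ite (R : Finset α) (p : ℝ) (E : Finset α → Prop) :
    subsetProb R p E = ∑ H ∈ R.powerset, weight R p H * if E H then 1 else 0 := by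
  simp [subsetProb, Finset.sum_filter]

theorem subsetProb_nonneg (hp : 0 ≤ p) (hp1 : p ≤ 1) : 0 ≤ subsetProb R p E :=
  Finset.sum_nonneg fun _ _ => weight_nonneg hp hp1 _

theorem subsetProb_mono (hp : 0 ≤ p) (hp1 : p ≤ 1) (h : ∀ H ⊆ R, E H → F H) :
    subsetProb R p E ≤ subsetProb R p F := by
  classical
  refine Finset.sum_le_sum_of_subset_of_nonneg (fun H hH => ?_)
    fun _ _ _ => weight_nonneg hp hp1 _
  obtain ⟨h1, h2⟩ := Finset.mem_filter.1 hH
  exact Finset.mem_filter.2 ⟨h1, h H (Finset.mem_powerset.1 h1) h2⟩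

theorem sum_weight_le_subsetProb (hp : 0 ≤ p) (hp1 : p ≤ 1) {S : Finset (Finset α)}
    (hS : ∀ H ∈ S, H ⊆ R ∧ E H) : ∑ H ∈ S, weight R p H ≤ subsetProb R p E := by
  classical
  refine Finset.sum_le_sum_of_subset_of_nonneg (fun H hH => ?_)
    fun _ _ _ => weight_nonneg hp hp1 _
  exact Finset.mem_filter.2 ⟨Finset.mem_powerset.2 (hS H hH).1, (hS H hH).2⟩

theorem subsetProb_congr (h : ∀ H ⊆ R, E H ↔ F H) : subsetProb R p E = subsetProb R p F := by
  classical
  simp only [subsetProb_eq_sum_ite]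
  refine Finset.sum_congr rfl fun H hH => ?_
  simp only [h H (Finset.mem_powerset.1 hH)]

theorem subsetProb_add_not (R : Finset α) (p : ℝ) (E : Finset α → Prop) :
    subsetProb R p E + subsetProb R p (fun H => ¬ E H) = 1 := by
  classical
  rw [← sum_weight R p, subsetProb, subsetProb]
  convert Finset.sum_filter_add_sum_filter_not R.powerset E (weight R p)

theorem subsetProb_le_one (hp : 0 ≤ p) (hp1 : p ≤ 1) : subsetProb R p E ≤ 1 := by
  have := subsetProb_add_not R p E
  have := subsetProb_nonneg (R := R) (E := fun H => ¬ E H) hp hp1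
  linarith

theorem subsetProb_exists_le (hp : 0 ≤ p) (hp1 : p ≤ 1) {ι : Type*} (I : Finset ι)
    (A : ι → Finset α → Prop) :
    subsetProb R p (fun H => ∃ i ∈ I, A i H) ≤ ∑ i ∈ I, subsetProb R p (A i) := by
  classical
  simp only [subsetProb_eq_sum_ite]
  rw [Finset.sum_comm]
  refine Finset.sum_le_sum fun H _ => ?_
  rw [← Finset.mul_sum]
  refine mul_le_mul_of_nonneg_left ?_ (weight_nonneg hp hp1 H)
  split_ifs with h
  · obtain ⟨i, hi, hA⟩ := h
    calc (1 : ℝ) = if A i H then 1 else 0 := by rw [if_pos hA]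
      _ ≤ _ := Finset.single_le_sum (f := fun i => if A i H then (1 : ℝ) else 0)
        (fun i _ => by positivity) hi
  · positivity

/-- **Second moment method.** -/
theorem sq_sum_subsetProb_le (hp : 0 ≤ p) (hp1 : p ≤ 1) {ι : Type*} (I : Finset ι)
    (A : ι → Finset α → Prop) :
    (∑ i ∈ I, subsetProb R p (A i)) ^ 2 ≤ subsetProb R p (fun H => ∃ i ∈ I, A i H) *
      ∑ i ∈ I, ∑ j ∈ I, subsetProb R p (fun H => A i H ∧ A j H) := by
  classical
  set X : Finset α → ℝ := fun H => ∑ i ∈ I, if A i H then 1 else 0 with hX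
  have h1 : ∑ i ∈ I, subsetProb R p (A i) = ∑ H ∈ R.powerset, weight R p H * X H := by
    simp only [subsetProb_eq_sum_ite, hX, Finset.mul_sum]
    rw [Finset.sum_comm]
  have h2 : ∑ i ∈ I, ∑ j ∈ I, subsetProb R p (fun H => A i H ∧ A j H) =
      ∑ H ∈ R.powerset, weight R p H * X H ^ 2 := by
    have hsq : ∀ H, X H ^ 2 = ∑ i ∈ I, ∑ j ∈ I, if A i H ∧ A j H then 1 else 0 := fun H => by
      rw [hX, sq, Finset.sum_mul_sum]
      refine Finset.sum_congr rfl fun i _ => Finset.sum_congr rfl fun j _ => ?_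
      split_ifs <;> simp_all
    simp only [subsetProb_eq_sum_ite, hsq]
    rw [Finset.sum_congr rfl fun i _ => Finset.sum_comm, Finset.sum_comm]
    simp only [Finset.mul_sum]
    congr! 8
  rw [h1, h2, subsetProb_eq_sum_ite]
  refine Finset.sum_sq_le_sum_mul_sum_of_sq_le_mul _ (fun H _ => ?_) (fun H _ => ?_) fun H _ => ?_
  · exact mul_nonneg (weight_nonneg hp hp1 H) (by positivity)
  · exact mul_nonneg (weight_nonneg hp hp1 H) (sq_nonneg _)
  · by_cases h : ∃ i ∈ I, A i H
    · rw [if_pos h]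
      exact le_of_eq (by ring)
    · have : X H = 0 := Finset.sum_eq_zero fun i hi => if_neg fun hA => h ⟨i, hi, hA⟩
      simp [this]

variable [DecidableEq α]

/-- Conditioning on `S` being present leaves an independent random subset of `R \ S`. -/
theorem subsetProb_superset_and {S : Finset α} (hS : S ⊆ R) :
    subsetProb R p (fun H => S ⊆ H ∧ E H) =
      p ^ S.card * subsetProb (R \ S) p (fun H => E (S ∪ H)) := by
  classical
  rw [subsetProb, subsetProb, Finset.mul_sum]
  refine Finset.sum_nbij' (fun H => H \ S) (fun H => S ∪ H) ?_ ?_ ?_ ?_ ?_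
  · intro H hH
    simp only [Finset.mem_filter, Finset.mem_powerset] at hH ⊢
    exact ⟨Finset.sdiff_subset_sdiff hH.1 subset_rfl,
      by rw [Finset.union_sdiff_of_subset hH.2.1]; exact hH.2.2⟩
  · intro H hH
    simp only [Finset.mem_filter, Finset.mem_powerset] at hH ⊢
    exact ⟨Finset.union_subset hS (hH.1.trans Finset.sdiff_subset), Finset.subset_union_left,
      hH.2⟩
  · intro H hH
    simp only [Finset.mem_filter, Finset.mem_powerset] at hH
    exact Finset.union_sdiff_of_subset hH.2.1
  · intro H hH
    simp only [Finset.mem_filter, Finset.mem_powerset] at hH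
    exact Finset.union_sdiff_cancel_left
      (Finset.disjoint_left.2 fun x hx hxH => (Finset.mem_sdiff.1 (hH.1 hxH)).2 hx)
  · intro H hH
    simp only [Finset.mem_filter, Finset.mem_powerset] at hH
    have h1 := Finset.card_sdiff_add_card_eq_card hH.2.1
    have h2 := Finset.card_sdiff_add_card_eq_card hS
    have h3 : R.card - H.card = (R \ S).card - (H \ S).card := by omega
    rw [weight, weight, h3, ← h1, pow_add]
    ring

theorem subsetProb_superset {S : Finset α} (hS : S ⊆ R) :
    subsetProb R p (fun H => S ⊆ H) = p ^ S.card := by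
  have h := subsetProb_superset_and (p := p) (E := fun _ => True) hS
  have h1 : subsetProb (R \ S) p (fun _ => True) = 1 := by
    classical
    simp [subsetProb_eq_sum_ite, sum_weight]
  rw [h1, mul_one] at h
  rw [← h]
  exact subsetProb_congr fun H _ => by simp

/-- **Harris' inequality** for two decreasing events. -/
theorem subsetProb_mul_le_and (hp : 0 ≤ p) (hp1 : p ≤ 1)
    (hE : ∀ H H', H ⊆ H' → E H' → E H) (hF : ∀ H H', H ⊆ H' → F H' → F H) :
    subsetProb R p E * subsetProb R p F ≤ subsetProb R p (fun H => E H ∧ F H) := by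
  classical
  have hw : (0 : Finset α → ℝ) ≤ weight R p := fun H => weight_nonneg hp hp1 H
  -- The weights satisfy `w(s) w(t) = w(s ∩ t) w(s ∪ t)`, so all four functions can be the weight.
  -- Intersections satisfy both decreasing events, and the unions have total weight at most one.
  have h4 := Finset.four_functions_theorem R hw hw hw hw (fun s hs t ht => ?_)
    (Finset.filter_subset E R.powerset) (Finset.filter_subset F R.powerset)
  · refine h4.trans ?_
    rw [← mul_one (subsetProb R p fun H => E H ∧ F H), ← sum_weight R p]
    refine mul_le_mul ?_ ?_ (Finset.sum_nonneg fun _ _ => weight_nonneg hp hp1 _)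
      (subsetProb_nonneg hp hp1)
    · refine Finset.sum_le_sum_of_subset_of_nonneg (fun H hH => ?_)
        fun _ _ _ => weight_nonneg hp hp1 _
      obtain ⟨s, hs, t, ht, rfl⟩ := Finset.mem_infs.1 hH
      simp only [Finset.mem_filter, Finset.mem_powerset] at hs ht ⊢
      exact ⟨Finset.inter_subset_left.trans hs.1, hE _ _ Finset.inter_subset_left hs.2,
        hF _ _ Finset.inter_subset_right ht.2⟩
    · refine Finset.sum_le_sum_of_subset_of_nonneg (fun H hH => ?_)
        fun _ _ _ => weight_nonneg hp hp1 _
      obtain ⟨s, hs, t, ht, rfl⟩ := Finset.mem_sups.1 hH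
      simp only [Finset.mem_filter, Finset.mem_powerset] at hs ht ⊢
      exact Finset.union_subset hs.1 ht.1
  · have h1 := Finset.card_union_add_card_inter s t
    have h2 := Finset.card_le_card hs
    have h3 := Finset.card_le_card ht
    have h4 := Finset.card_le_card (Finset.union_subset hs ht)
    have h5 := Finset.card_le_card (Finset.inter_subset_left (s₁ := s) (s₂ := t))
    have e1 : p ^ s.card * p ^ t.card = p ^ (s ∩ t).card * p ^ (s ∪ t).card := by
      rw [← pow_add, ← pow_add]
      congr 1
      omega
    have e2 : (1 - p) ^ (R.card - s.card) * (1 - p) ^ (R.card - t.card) =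
        (1 - p) ^ (R.card - (s ∩ t).card) * (1 - p) ^ (R.card - (s ∪ t).card) := by
      rw [← pow_add, ← pow_add]
      congr 1
      omega
    refine le_of_eq ?_
    simp only [weight]
    linear_combination (1 - p) ^ (R.card - s.card) * (1 - p) ^ (R.card - t.card) * e1 +
      p ^ (s ∩ t).card * p ^ (s ∪ t).card * e2

theorem prod_le_subsetProb_forall_not_subset (hp : 0 ≤ p) (hp1 : p ≤ 1)
    (B : Finset (Finset α)) (hB : ∀ T ∈ B, T ⊆ R) :
    ∏ T ∈ B, (1 - p ^ T.card) ≤ subsetProb R p (fun H => ∀ T ∈ B, ¬ T ⊆ H) := by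
  induction B using Finset.induction_on with
  | empty =>
    simp [subsetProb, sum_weight]
  | insert T B hT ih =>
    rw [Finset.prod_insert hT]
    have h1 : 1 - p ^ T.card = subsetProb R p (fun H => ¬ T ⊆ H) := by
      have h2 := subsetProb_add_not R p fun H => T ⊆ H
      rw [subsetProb_superset (hB T (Finset.mem_insert_self T B))] at h2
      linarith
    calc (1 - p ^ T.card) * ∏ T ∈ B, (1 - p ^ T.card)
        ≤ subsetProb R p (fun H => ¬ T ⊆ H) *
          subsetProb R p (fun H => ∀ T ∈ B, ¬ T ⊆ H) := by
          rw [h1]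
          exact mul_le_mul_of_nonneg_left
            (ih fun T hT => hB T (Finset.mem_insert_of_mem hT)) (subsetProb_nonneg hp hp1)
      _ ≤ _ := subsetProb_mul_le_and hp hp1 (fun H H' h hE hT => hE (hT.trans h))
          fun H H' h hF T hT hTH => hF T hT (hTH.trans h)
      _ = _ := subsetProb_congr fun H _ => by simp

/-- Harris' inequality gives the product of the `1 - p ^ T.card`, and `1 - x ≥ exp (-2x)` for `0 ≤ x
≤ 1/2`. Nonemptiness of `T` ensures `p ^ T.card ≤ p ≤ 1/2`. -/
theorem exp_le_subsetProb_forall_not_subset (hp : 0 ≤ p) (hp2 : p ≤ 1 / 2)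
    (B : Finset (Finset α)) (hB : ∀ T ∈ B, T ⊆ R ∧ T.Nonempty) :
    Real.exp (-2 * ∑ T ∈ B, p ^ T.card) ≤ subsetProb R p (fun H => ∀ T ∈ B, ¬ T ⊆ H) := by
  refine le_trans ?_ (prod_le_subsetProb_forall_not_subset hp (by linarith) B
    fun T hT => (hB T hT).1)
  rw [Finset.mul_sum, Real.exp_sum]
  refine Finset.prod_le_prod (fun _ _ => (Real.exp_pos _).le) fun T hT => ?_
  have hx : p ^ T.card ≤ 1 / 2 := by
    calc p ^ T.card ≤ p ^ 1 :=
          pow_le_pow_of_le_one hp (by linarith) (hB T hT).2.card_pos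
      _ ≤ 1 / 2 := by rw [pow_one]; exact hp2
  have hx0 : 0 ≤ p ^ T.card := pow_nonneg hp _
  generalize p ^ T.card = x at hx hx0
  have h1 := Real.one_sub_inv_le_log_of_pos (by linarith : 0 < 1 - x)
  rw [← Real.le_log_iff_exp_le (by linarith)]
  refine le_trans ?_ h1
  have h2 : (1 - x)⁻¹ ≤ 1 + 2 * x := by
    rw [inv_le_comm₀ (by linarith) (by linarith), inv_le_iff_one_le_mul₀ (by linarith)]
    nlinarith
  linarith

end RandomSubset

/-! ### First moments -/

theorem rpow_neg_pow {n : ℕ} (β : ℝ) (s : ℕ) :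
    ((n : ℝ) ^ (-β)) ^ s = (n : ℝ) ^ (-(β * s)) := by
  rw [← Real.rpow_mul_natCast (Nat.cast_nonneg n), neg_mul]

theorem edgeProb_eq (d : ℕ) (δ : ℝ) (n : ℕ) :
    edgeProb d δ n = (n : ℝ) ^ (-((d : ℝ) - 1 - δ)) := by
  rw [edgeProb]
  ring_nf

/-- By the binomial theorem the sum is `(1 + 1/n) ^ n`, which is at most `e`. -/
theorem sum_inv_pow_card_le {n : ℕ} (hn : 1 ≤ n) :
    ∑ X : Finset (Fin n), ((n : ℝ)⁻¹) ^ X.card ≤ 3 := by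
  have h := Finset.sum_pow_mul_eq_add_pow ((n : ℝ)⁻¹) 1 (Finset.univ : Finset (Fin n))
  simp only [one_pow, mul_one, Finset.powerset_univ, Finset.card_univ, Fintype.card_fin] at h
  rw [h]
  have hn0 : (n : ℝ) ≠ 0 := by positivity
  calc ((n : ℝ)⁻¹ + 1) ^ n ≤ Real.exp ((n : ℝ)⁻¹) ^ n :=
        pow_le_pow_left₀ (by positivity) (Real.add_one_le_exp _) n
    _ = Real.exp 1 := by rw [← Real.exp_nat_mul, mul_inv_cancel₀ hn0]
    _ ≤ 3 := Real.exp_one_lt_three.le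

/-- There are about `n ^ v` hypergraphs of bounded size which span `v` vertices outside `W`. -/
theorem sum_inv_pow_card_biUnion_le {n : ℕ} (hn : 1 ≤ n) (W : Finset (Fin n)) (M : ℕ) :
    ∑ T : Finset (Finset (Fin n)) with (T.biUnion id \ W).card ≤ M,
      ((n : ℝ)⁻¹) ^ (T.biUnion id \ W).card ≤ 3 * 2 ^ 2 ^ (M + W.card) := by
  rw [← Finset.sum_fiberwise _ fun T => T.biUnion id \ W]
  have hfib : ∀ X : Finset (Fin n),
      ∑ T ∈ (Finset.univ.filter fun T : Finset (Finset (Fin n)) =>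
        (T.biUnion id \ W).card ≤ M) with T.biUnion id \ W = X,
        ((n : ℝ)⁻¹) ^ (T.biUnion id \ W).card ≤ 2 ^ 2 ^ (M + W.card) * ((n : ℝ)⁻¹) ^ X.card := by
    intro X
    rw [Finset.sum_congr rfl (g := fun _ => ((n : ℝ)⁻¹) ^ X.card)
      fun T hT => by rw [(Finset.mem_filter.1 hT).2], Finset.sum_const, nsmul_eq_mul]
    refine mul_le_mul_of_nonneg_right ?_ (by positivity)
    by_cases hX : X.card ≤ M
    · have hsub : (Finset.univ.filter fun T : Finset (Finset (Fin n)) =>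
          (T.biUnion id \ W).card ≤ M).filter (fun T => T.biUnion id \ W = X) ⊆
          (X ∪ W).powerset.powerset := by
        intro T hT
        rw [Finset.mem_powerset]
        intro t ht
        rw [Finset.mem_powerset, ← (Finset.mem_filter.1 hT).2, Finset.sdiff_union_self_eq_union]
        exact (Finset.subset_biUnion_of_mem id ht).trans Finset.subset_union_left
      have h1 := Finset.card_le_card hsub
      rw [Finset.card_powerset, Finset.card_powerset] at h1
      have h2 : (X ∪ W).card ≤ M + W.card :=
        (Finset.card_union_le X W).trans (Nat.add_le_add_right hX _)
      exact_mod_cast h1.trans (Nat.pow_le_pow_right (by norm_num)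
        (Nat.pow_le_pow_right (by norm_num) h2))
    · rw [Finset.card_eq_zero.2]
      · simp
      · refine Finset.filter_eq_empty_iff.2 fun T hT h => hX ?_
        rw [← h]
        exact (Finset.mem_filter.1 hT).2
  calc _ ≤ ∑ X : Finset (Fin n), 2 ^ 2 ^ (M + W.card) * ((n : ℝ)⁻¹) ^ X.card :=
        Finset.sum_le_sum fun X _ => hfib X
    _ = 2 ^ 2 ^ (M + W.card) * ∑ X : Finset (Fin n), ((n : ℝ)⁻¹) ^ X.card :=
        (Finset.mul_sum _ _ _).symm
    _ ≤ 2 ^ 2 ^ (M + W.card) * 3 :=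
        mul_le_mul_of_nonneg_left (sum_inv_pow_card_le hn) (by positivity)
    _ = _ := mul_comm _ _

theorem card_biUnion_le_of_sized {V : Type*} [DecidableEq V] {d : ℕ} {S : Finset (Finset V)}
    (hS : (S : Set (Finset V)).Sized d) : (S.biUnion id).card ≤ S.card * d :=
  Finset.card_biUnion_le_card_mul _ _ _ fun _ hs => (hS hs).le

theorem sized_of_subset_allHyperedges {n d : ℕ} {H : Finset (Finset (Fin n))}
    (hH : H ⊆ allHyperedges n d) : (H : Set (Finset (Fin n))).Sized d :=
  fun _ hh => (Finset.mem_powersetCard.1 (hH hh)).2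

theorem subset_allHyperedges_of_sized {n d : ℕ} {H : Finset (Finset (Fin n))}
    (hH : (H : Set (Finset (Fin n))).Sized d) : H ⊆ allHyperedges n d :=
  fun _ hh => Finset.mem_powersetCard.2 ⟨Finset.subset_univ _, hH hh⟩

/-- Only finitely many pairs `(v, s)` occur, so one `ε` serves for all strict inequalities and
yields a uniform factor `n ^ (-ε)` in the first moment. -/
theorem exists_gap (β : ℝ) (M L : ℕ) :
    ∃ ε > 0, ∀ v ≤ M, ∀ s ≤ L, (v : ℝ) < β * s → v + ε ≤ β * s := by
  have h : ∀ᶠ ε : ℝ in 𝓝[>] 0, ∀ x ∈ Finset.range (M + 1) ×ˢ Finset.range (L + 1),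
      (x.1 : ℝ) < β * x.2 → x.1 + ε ≤ β * x.2 := by
    rw [Filter.eventually_all_finset]
    rintro ⟨v, s⟩ -
    by_cases hx : (v : ℝ) < β * s
    · filter_upwards [Ioo_mem_nhdsGT (sub_pos.2 hx)] with ε hε _
      linarith [hε.2]
    · exact Eventually.of_forall fun ε h => absurd h hx
  obtain ⟨ε, hε, hpos⟩ := (h.and self_mem_nhdsWithin).exists
  exact ⟨ε, hpos, fun v hv s hs => hε (v, s)
    (Finset.mem_product.2 ⟨Finset.mem_range.2 (by omega), Finset.mem_range.2 (by omega)⟩)⟩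

/-- Small sets of hyperedges which span too few vertices do not appear. -/
theorem tendsto_prob_not_spansUpTo {d : ℕ} {δ : ℝ} (hδ : δ < d - 1) (L : ℕ) :
    Tendsto (fun n : ℕ => prob n d (edgeProb d δ n) fun H => ¬ SpansUpTo ((d : ℝ) - 1 - δ) L H)
      atTop (𝓝 0) := by
  obtain ⟨ε, hε, hgap⟩ := exists_gap ((d : ℝ) - 1 - δ) (L * d) L
  set β := (d : ℝ) - 1 - δ with hβ
  have hlim : Tendsto (fun n : ℕ => (n : ℝ) ^ (-ε) * (3 * 2 ^ 2 ^ (L * d))) atTop (𝓝 0) := by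
    rw [← zero_mul (3 * 2 ^ 2 ^ (L * d) : ℝ)]
    exact ((tendsto_rpow_neg_atTop hε).comp tendsto_natCast_atTop_atTop).mul_const _
  refine squeeze_zero' (Eventually.of_forall fun n => ?_) ?_ hlim
  · rw [prob_eq_subsetProb]
    exact subsetProb_nonneg (edgeProb_mem d δ hδ n).1 (edgeProb_mem d δ hδ n).2
  · filter_upwards [eventually_ge_atTop 1] with n hn
    classical
    have hn1 : (1 : ℝ) ≤ n := by exact_mod_cast hn
    obtain ⟨hp, hp1⟩ := edgeProb_mem d δ hδ n
    set B := (allHyperedges n d).powerset.filter fun S =>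
      S.card ≤ L ∧ ((S.biUnion id).card : ℝ) < β * S.card with hB
    have hmem : ∀ S ∈ B, S ⊆ allHyperedges n d ∧ S.card ≤ L ∧
        ((S.biUnion id).card : ℝ) < β * S.card ∧ (S.biUnion id).card ≤ L * d := by
      intro S hS
      obtain ⟨h1, h2, h3⟩ := Finset.mem_filter.1 hS
      rw [Finset.mem_powerset] at h1
      exact ⟨h1, h2, h3, (card_biUnion_le_of_sized (sized_of_subset_allHyperedges h1)).trans
        (Nat.mul_le_mul_right d h2)⟩
    rw [prob_eq_subsetProb]
    calc subsetProb (allHyperedges n d) (edgeProb d δ n) (fun H => ¬ SpansUpTo β L H)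
        ≤ subsetProb (allHyperedges n d) (edgeProb d δ n) (fun H => ∃ S ∈ B, S ⊆ H) := by
          refine subsetProb_mono hp hp1 fun H hH hnot => ?_
          unfold SpansUpTo at hnot
          push Not at hnot
          obtain ⟨S, h1, h2, h3⟩ := hnot
          exact ⟨S, Finset.mem_filter.2 ⟨Finset.mem_powerset.2 (h1.trans hH), h2, h3⟩, h1⟩
      _ ≤ ∑ S ∈ B, subsetProb (allHyperedges n d) (edgeProb d δ n) (fun H => S ⊆ H) :=
          subsetProb_exists_le hp hp1 B _
      _ ≤ ∑ S ∈ B, (n : ℝ) ^ (-ε) * ((n : ℝ)⁻¹) ^ (S.biUnion id \ ∅).card := by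
          refine Finset.sum_le_sum fun S hS => ?_
          obtain ⟨h1, h2, h3, h4⟩ := hmem S hS
          rw [subsetProb_superset h1, edgeProb_eq, rpow_neg_pow, Finset.sdiff_empty,
            inv_pow, ← Real.rpow_natCast, ← Real.rpow_neg (by linarith),
            ← Real.rpow_add (by linarith)]
          have := hgap _ h4 _ h2 h3
          exact Real.rpow_le_rpow_of_exponent_le hn1 (by linarith)
      _ = (n : ℝ) ^ (-ε) * ∑ S ∈ B, ((n : ℝ)⁻¹) ^ (S.biUnion id \ ∅).card :=
          (Finset.mul_sum _ _ _).symm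
      _ ≤ (n : ℝ) ^ (-ε) * (3 * 2 ^ 2 ^ (L * d)) := by
          refine mul_le_mul_of_nonneg_left ?_ (by positivity)
          refine le_trans (Finset.sum_le_sum_of_subset_of_nonneg (fun S hS => ?_)
            fun _ _ _ => by positivity) (sum_inv_pow_card_biUnion_le hn ∅ (L * d))
          rw [Finset.mem_filter, Finset.sdiff_empty]
          exact ⟨Finset.mem_univ _, (hmem S hS).2.2.2⟩

/-! ### Appearance of a fixed component -/

section Appearance

variable {n m d : ℕ}

open Classical in
/-- The small sets of hyperedges outside `S` which could enlarge a component with hyperedges `S`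
and vertices in `W`. -/
noncomputable def enlargements (d : ℕ) (β : ℝ) (S : Finset (Finset (Fin n)))
    (W : Finset (Fin n)) : Finset (Finset (Finset (Fin n))) :=
  (allHyperedges n d \ S).powerset.filter fun T =>
    T.Nonempty ∧ T.card ≤ d ^ 2 ∧ ((T.biUnion id \ W).card : ℝ) ≤ β * T.card

/-- The copy of `R` under `φ` is contained in `H`, and `H` does not enlarge it. -/
def IsIsolatedCopy (d : ℕ) (β : ℝ) (R : Finset (Finset (Fin m))) (φ : Fin m ↪ Fin n)
    (H : Finset (Finset (Fin n))) : Prop :=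
  copy φ R ⊆ H ∧ ∀ T ∈ enlargements d β (copy φ R) (Finset.univ.map φ), ¬ T ⊆ H

theorem biUnion_copy_subset (φ : Fin m ↪ Fin n) (R : Finset (Finset (Fin m))) :
    (copy φ R).biUnion id ⊆ Finset.univ.map φ := by
  rw [biUnion_copy]
  exact Finset.map_subset_map.2 (Finset.subset_univ _)

/-- A clique that attaches to the copy without belonging to it would need a completion `T`, which
the growth bound places among the excluded enlargements. -/
theorem IsIsolatedCopy.appearsAsComponent {β : ℝ} (hd : 2 ≤ d)
    (hβ : d * (d - 1) ≤ (d + 1) * β) {R : Finset (Finset (Fin m))}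
    (hconn : IsTwoConnComponent ((proj R).cliqueSet d) ((proj R).cliqueSet d))
    {φ : Fin m ↪ Fin n} {H : Finset (Finset (Fin n))} (hH : H ⊆ allHyperedges n d)
    (hiso : IsIsolatedCopy d β R φ H) : AppearsAsComponent d (proj R) (proj H) := by
  refine ⟨φ, ?_⟩
  have hcopy := (isTwoConnComponent_map φ).2 hconn
  rw [← SimpleGraph.cliqueSet_map (by omega : d ≠ 1), ← proj_copy] at hcopy
  rw [← proj_copy]
  obtain ⟨-, hne, -, hcon⟩ := isTwoConnComponent_iff.1 hcopy
  refine isTwoConnComponent_iff.2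
    ⟨SimpleGraph.cliqueSet_mono (proj_mono hiso.1), hne, fun c hc c' hc' h2 => ?_, hcon⟩
  by_contra hnot
  obtain ⟨T, hT, hTn, hTc, -, hTg⟩ := exists_completion (sized_of_subset_allHyperedges hH)
    (biUnion_copy_subset φ R) hc' hnot (h2.trans (Finset.card_le_card fun x hx =>
      Finset.mem_inter.2 ⟨(Finset.mem_inter.1 hx).2, biUnion_copy_subset φ R
        (subset_biUnion_of_mem_cliqueSet hd hc (Finset.mem_inter.1 hx).1)⟩))
  refine hiso.2 T (Finset.mem_filter.2 ⟨Finset.mem_powerset.2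
    (hT.trans (Finset.sdiff_subset_sdiff hH subset_rfl)), hTn, hTc, ?_⟩)
    (hT.trans Finset.sdiff_subset)
  have h1 : ((d : ℝ) + 1) * (T.biUnion id \ Finset.univ.map φ).card ≤ d * (d - 1) * T.card := by
    have : ((d - 1 : ℕ) : ℝ) = d - 1 := by rw [Nat.cast_sub (by omega)]; simp
    rw [← this]
    exact_mod_cast hTg
  have h2 := mul_le_mul_of_nonneg_right hβ (Nat.cast_nonneg T.card)
  have h3 : (0 : ℝ) < d + 1 := by positivity
  refine le_of_mul_le_mul_left ?_ h3
  linarith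

/-- Lower bound for the probability of an isolated copy. -/
theorem le_subsetProb_isIsolatedCopy {β : ℝ} (hn : 1 ≤ n)
    (hp1 : (n : ℝ) ^ (-β) ≤ 1 / 2) {R : Finset (Finset (Fin m))}
    (hR : (R : Set (Finset (Fin m))).Sized d) (φ : Fin m ↪ Fin n) :
    ((n : ℝ) ^ (-β)) ^ R.card * Real.exp (-2 * (3 * 2 ^ 2 ^ (d ^ 2 * d + m))) ≤
      subsetProb (allHyperedges n d) ((n : ℝ) ^ (-β)) (IsIsolatedCopy d β R φ) := by
  have hp : 0 ≤ (n : ℝ) ^ (-β) := by positivity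
  have hn1 : (1 : ℝ) ≤ n := by exact_mod_cast hn
  have hsub := subset_allHyperedges_of_sized (copy_sized (φ := φ).2 hR)
  set B := enlargements d β (copy φ R) (Finset.univ.map φ) with hB
  have hmem : ∀ T ∈ B, T ⊆ allHyperedges n d \ copy φ R ∧ T.Nonempty ∧ T.card ≤ d ^ 2 ∧
      ((T.biUnion id \ Finset.univ.map φ).card : ℝ) ≤ β * T.card := fun T hT => by
    obtain ⟨h1, h2, h3, h4⟩ := Finset.mem_filter.1 hT
    exact ⟨Finset.mem_powerset.1 h1, h2, h3, h4⟩
  -- Each enlargement has at most `β` new vertices per hyperedge, so the expected number present is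
  -- bounded independently of `n`, also at the critical density.
  have hsum : ∑ T ∈ B, ((n : ℝ) ^ (-β)) ^ T.card ≤ 3 * 2 ^ 2 ^ (d ^ 2 * d + m) := by
    calc ∑ T ∈ B, ((n : ℝ) ^ (-β)) ^ T.card
        ≤ ∑ T ∈ B, ((n : ℝ)⁻¹) ^ (T.biUnion id \ Finset.univ.map φ).card := by
          refine Finset.sum_le_sum fun T hT => ?_
          rw [rpow_neg_pow, inv_pow, ← Real.rpow_natCast, ← Real.rpow_neg (by linarith)]
          exact Real.rpow_le_rpow_of_exponent_le hn1 (by linarith [(hmem T hT).2.2.2])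
      _ ≤ 3 * 2 ^ 2 ^ (d ^ 2 * d + (Finset.univ.map φ).card) := by
          refine le_trans (Finset.sum_le_sum_of_subset_of_nonneg (fun T hT => ?_)
            fun _ _ _ => by positivity) (sum_inv_pow_card_biUnion_le hn _ (d ^ 2 * d))
          obtain ⟨h1, -, h3, -⟩ := hmem T hT
          refine Finset.mem_filter.2 ⟨Finset.mem_univ _, ?_⟩
          exact (Finset.card_le_card Finset.sdiff_subset).trans ((card_biUnion_le_of_sized
            (sized_of_subset_allHyperedges (h1.trans Finset.sdiff_subset))).trans
              (Nat.mul_le_mul_right d h3))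
      _ = _ := by simp
  have hiso : subsetProb (allHyperedges n d) ((n : ℝ) ^ (-β)) (IsIsolatedCopy d β R φ) =
      ((n : ℝ) ^ (-β)) ^ R.card * subsetProb (allHyperedges n d \ copy φ R) ((n : ℝ) ^ (-β))
        (fun H => ∀ T ∈ B, ¬ T ⊆ H) := by
    rw [← card_copy φ R, show IsIsolatedCopy d β R φ = fun H => copy φ R ⊆ H ∧
      ∀ T ∈ B, ¬ T ⊆ H from rfl, subsetProb_superset_and hsub]
    congr 1
    refine subsetProb_congr fun H _ => forall₂_congr fun T hT => not_congr ?_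
    refine ⟨fun h x hx => ?_, fun h => h.trans Finset.subset_union_right⟩
    exact (Finset.mem_union.1 (h hx)).resolve_left (Finset.mem_sdiff.1 ((hmem T hT).1 hx)).2
  rw [hiso]
  refine mul_le_mul_of_nonneg_left ?_ (pow_nonneg hp _)
  refine le_trans (Real.exp_le_exp.2 ?_) (exp_le_subsetProb_forall_not_subset hp hp1 B
    fun T hT => ⟨(hmem T hT).1, (hmem T hT).2.1⟩)
  linarith

/-- Upper bound for the probability of two given copies. -/
theorem subsetProb_two_copies_le {β : ℝ} (hn : 1 ≤ n) (hp1 : (n : ℝ) ^ (-β) ≤ 1)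
    {R : Finset (Finset (Fin m))} (hR : (R : Set (Finset (Fin m))).Sized d) (hspan : Spans β R)
    (φ ψ : Fin m ↪ Fin n) :
    subsetProb (allHyperedges n d) ((n : ℝ) ^ (-β))
      (fun H => IsIsolatedCopy d β R φ H ∧ IsIsolatedCopy d β R ψ H) ≤
      ((n : ℝ) ^ (-β)) ^ (2 * R.card) *
        (n : ℝ) ^ (Finset.univ.filter fun w => ψ w ∈ Finset.univ.map φ).card := by
  have hp : 0 ≤ (n : ℝ) ^ (-β) := by positivity
  have hn1 : (1 : ℝ) ≤ n := by exact_mod_cast hn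
  have hφ := subset_allHyperedges_of_sized (copy_sized (φ := φ).2 hR)
  have hψ := subset_allHyperedges_of_sized (copy_sized (φ := ψ).2 hR)
  set t := (Finset.univ.filter fun w => ψ w ∈ Finset.univ.map φ).card with ht
  -- The shared hyperedges form a copy of a subset of `R`, so `Spans` bounds them by the number `t`
  -- of shared vertices. Thus `n ^ t` pays for the probability saved by the overlap.
  have hinter : β * (copy φ R ∩ copy ψ R).card ≤ t := by
    obtain ⟨S, hS, hSeq⟩ := Finset.subset_map_iff.1
      (Finset.inter_subset_right (s₁ := copy φ R) (s₂ := copy ψ R))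
    have hSc : copy φ R ∩ copy ψ R = copy ψ S := hSeq
    rw [hSc, card_copy]
    refine (hspan S hS).trans ?_
    have : S.biUnion id ⊆ Finset.univ.filter fun w => ψ w ∈ Finset.univ.map φ := by
      intro w hw
      refine Finset.mem_filter.2 ⟨Finset.mem_univ _, biUnion_copy_subset φ R ?_⟩
      have h1 : ψ w ∈ (copy ψ S).biUnion id := by
        rw [biUnion_copy]
        exact Finset.mem_map_of_mem ψ hw
      rw [← hSc] at h1
      exact Finset.biUnion_subset_biUnion_of_subset_left _ Finset.inter_subset_left h1
    exact_mod_cast Finset.card_le_card this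
  calc subsetProb (allHyperedges n d) ((n : ℝ) ^ (-β))
          (fun H => IsIsolatedCopy d β R φ H ∧ IsIsolatedCopy d β R ψ H)
      ≤ subsetProb (allHyperedges n d) ((n : ℝ) ^ (-β)) (fun H => copy φ R ∪ copy ψ R ⊆ H) :=
        subsetProb_mono hp hp1 fun H _ h => Finset.union_subset h.1.1 h.2.1
    _ = ((n : ℝ) ^ (-β)) ^ (copy φ R ∪ copy ψ R).card :=
        subsetProb_superset (Finset.union_subset hφ hψ)
    _ ≤ ((n : ℝ) ^ (-β)) ^ (copy φ R ∪ copy ψ R).card *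
        (((n : ℝ) ^ (-β)) ^ (copy φ R ∩ copy ψ R).card * (n : ℝ) ^ t) := by
        refine le_mul_of_one_le_right (pow_nonneg hp _) ?_
        rw [rpow_neg_pow, ← Real.rpow_natCast, ← Real.rpow_add (by linarith)]
        exact Real.one_le_rpow hn1 (by linarith)
    _ = _ := by
        rw [← mul_assoc, ← pow_add, Finset.card_union_add_card_inter, card_copy, card_copy,
          two_mul]

/-- Extending the sum to all functions makes it a product over the coordinates, each contributing at
most `(|X| + 1) n`. -/
theorem sum_pow_card_filter_le (hn : 1 ≤ n) (X : Finset (Fin n)) :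
    ∑ ψ : Fin m ↪ Fin n, (n : ℝ) ^ (Finset.univ.filter fun w => ψ w ∈ X).card ≤
      ((X.card + 1) * n : ℝ) ^ m := by
  have hn1 : (1 : ℝ) ≤ n := by exact_mod_cast hn
  calc ∑ ψ : Fin m ↪ Fin n, (n : ℝ) ^ (Finset.univ.filter fun w => ψ w ∈ X).card
      = ∑ f ∈ Finset.univ.map (⟨fun ψ : Fin m ↪ Fin n => (ψ : Fin m → Fin n),
          DFunLike.coe_injective⟩ : (Fin m ↪ Fin n) ↪ (Fin m → Fin n)),
          (n : ℝ) ^ (Finset.univ.filter fun w => f w ∈ X).card := by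
        rw [Finset.sum_map]
        rfl
    _ ≤ ∑ f : Fin m → Fin n, (n : ℝ) ^ (Finset.univ.filter fun w => f w ∈ X).card :=
        Finset.sum_le_sum_of_subset_of_nonneg (Finset.subset_univ _)
          fun _ _ _ => by positivity
    _ = ∑ f : Fin m → Fin n, ∏ w, if f w ∈ X then (n : ℝ) else 1 := by
        refine Finset.sum_congr rfl fun f _ => ?_
        rw [Finset.prod_ite, Finset.prod_const, Finset.prod_const_one, mul_one]
    _ = ∏ _w : Fin m, ∑ v : Fin n, if v ∈ X then (n : ℝ) else 1 := by
        rw [Finset.prod_univ_sum, Fintype.piFinset_univ]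
    _ = (∑ v : Fin n, if v ∈ X then (n : ℝ) else 1) ^ m := by simp
    _ ≤ ((X.card + 1) * n : ℝ) ^ m := by
        refine pow_le_pow_left₀ (Finset.sum_nonneg fun _ _ => by positivity) ?_ m
        calc ∑ v : Fin n, (if v ∈ X then (n : ℝ) else 1)
            ≤ ∑ v : Fin n, ((if v ∈ X then (n : ℝ) else 0) + 1) :=
              Finset.sum_le_sum fun v _ => by split_ifs <;> linarith
          _ = (X.card + 1) * n := by
              rw [Finset.sum_add_distrib]
              simp
              ring

theorem half_pow_le_card_embedding (hn : 2 * m ≤ n) :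
    ((n : ℝ) / 2) ^ m ≤ Fintype.card (Fin m ↪ Fin n) := by
  rw [Fintype.card_embedding_eq, Fintype.card_fin, Fintype.card_fin]
  refine le_trans ?_ (Nat.cast_le.2 (Nat.pow_sub_le_descFactorial n m))
  rw [Nat.cast_pow]
  refine pow_le_pow_left₀ (by positivity) ?_ m
  rw [Nat.cast_sub (by omega)]
  have : (2 : ℝ) * m ≤ n := by exact_mod_cast hn
  push_cast
  linarith

end Appearance

/-- Below the critical density, an obstruction appears with positive probability. -/
theorem exists_le_prob_appearsAsComponent {d m : ℕ} (hd : 2 ≤ d) {δ : ℝ}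
    (hδ : δ ≤ (d - 1) / (d + 1)) {R : Finset (Finset (Fin m))}
    (hR : IsObstruction d ((d : ℝ) - 1 - δ) R) :
    ∃ c : ℝ, 0 < c ∧ ∀ᶠ n : ℕ in atTop,
      c ≤ prob n d (edgeProb d δ n) fun H => AppearsAsComponent d (proj R) (proj H) := by
  set β := (d : ℝ) - 1 - δ with hβdef
  have hdR : (2 : ℝ) ≤ d := by exact_mod_cast hd
  have hβ : d * (d - 1) ≤ (d + 1) * β := by
    rw [le_div_iff₀ (by positivity)] at hδ
    nlinarith
  have hβ0 : 0 < β := by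
    by_contra! h
    nlinarith
  set γ := Real.exp (-2 * (3 * 2 ^ 2 ^ (d ^ 2 * d + m))) with hγ
  have hγ0 : 0 < γ := Real.exp_pos _
  -- The squared first moment over the second moment: `γ` comes from isolation, `(1/2) ^ m` from
  -- counting embeddings, `(m+1) ^ m` from overlapping copies. The powers of `n ^ m * p ^ R.card`
  -- cancel.
  refine ⟨(γ * (1 / 2) ^ m) ^ 2 / ((m : ℝ) + 1) ^ m, by positivity, ?_⟩
  have hsmall : ∀ᶠ n : ℕ in atTop, (n : ℝ) ^ (-β) < 1 / 2 :=
    ((tendsto_rpow_neg_atTop hβ0).comp tendsto_natCast_atTop_atTop).eventually_lt_const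
      (by norm_num)
  filter_upwards [hsmall, eventually_ge_atTop 1, eventually_ge_atTop (2 * m)] with n hp2 hn hnm
  rw [prob_eq_subsetProb, edgeProb_eq, ← hβdef]
  have hn1 : (1 : ℝ) ≤ n := by exact_mod_cast hn
  set p := (n : ℝ) ^ (-β) with hp
  have hp0 : 0 < p := by positivity
  have hp1 : p ≤ 1 := by linarith
  have h2nd := sq_sum_subsetProb_le (R := allHyperedges n d) hp0.le hp1
    (Finset.univ : Finset (Fin m ↪ Fin n)) (IsIsolatedCopy d β R)
  have hlow : (n : ℝ) ^ m * (p ^ R.card * (γ * (1 / 2) ^ m)) ≤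
      ∑ φ : Fin m ↪ Fin n, subsetProb (allHyperedges n d) p (IsIsolatedCopy d β R φ) := by
    calc (n : ℝ) ^ m * (p ^ R.card * (γ * (1 / 2) ^ m))
        = ((n : ℝ) / 2) ^ m * (p ^ R.card * γ) := by rw [div_pow, div_pow]; ring
      _ ≤ Fintype.card (Fin m ↪ Fin n) * (p ^ R.card * γ) :=
          mul_le_mul_of_nonneg_right (half_pow_le_card_embedding hnm) (by positivity)
      _ = ∑ _φ : Fin m ↪ Fin n, p ^ R.card * γ := by simp
      _ ≤ _ := Finset.sum_le_sum fun φ _ =>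
          le_subsetProb_isIsolatedCopy hn hp2.le hR.sized φ
  have hup : ∑ φ : Fin m ↪ Fin n, ∑ ψ : Fin m ↪ Fin n, subsetProb (allHyperedges n d) p
      (fun H => IsIsolatedCopy d β R φ H ∧ IsIsolatedCopy d β R ψ H) ≤
      ((n : ℝ) ^ m * p ^ R.card) ^ 2 * ((m : ℝ) + 1) ^ m := by
    calc ∑ φ : Fin m ↪ Fin n, ∑ ψ : Fin m ↪ Fin n, subsetProb (allHyperedges n d) p
          (fun H => IsIsolatedCopy d β R φ H ∧ IsIsolatedCopy d β R ψ H)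
        ≤ ∑ _φ : Fin m ↪ Fin n, p ^ (2 * R.card) * (((m : ℝ) + 1) * n) ^ m := by
          refine Finset.sum_le_sum fun φ _ => ?_
          refine (Finset.sum_le_sum fun ψ _ =>
            subsetProb_two_copies_le hn hp1 hR.sized hR.spans φ ψ).trans ?_
          rw [← Finset.mul_sum]
          refine mul_le_mul_of_nonneg_left ?_ (by positivity)
          simpa using sum_pow_card_filter_le (m := m) hn (Finset.univ.map φ)
      _ = Fintype.card (Fin m ↪ Fin n) * (p ^ (2 * R.card) * (((m : ℝ) + 1) * n) ^ m) := by simp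
      _ ≤ (n : ℝ) ^ m * (p ^ (2 * R.card) * (((m : ℝ) + 1) * n) ^ m) := by
          refine mul_le_mul_of_nonneg_right ?_ (by positivity)
          rw [Fintype.card_embedding_eq, Fintype.card_fin, Fintype.card_fin]
          exact_mod_cast Nat.descFactorial_le_pow n m
      _ = _ := by rw [mul_pow, mul_pow, pow_mul']; ring
  set q := subsetProb (allHyperedges n d) p
    (fun H => ∃ φ ∈ (Finset.univ : Finset (Fin m ↪ Fin n)), IsIsolatedCopy d β R φ H) with hq
  have hq0 : 0 ≤ q := subsetProb_nonneg hp0.le hp1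
  have hmain : ((n : ℝ) ^ m * p ^ R.card) ^ 2 * (γ * (1 / 2) ^ m) ^ 2 ≤
      ((n : ℝ) ^ m * p ^ R.card) ^ 2 * (q * ((m : ℝ) + 1) ^ m) := by
    calc ((n : ℝ) ^ m * p ^ R.card) ^ 2 * (γ * (1 / 2) ^ m) ^ 2
        = ((n : ℝ) ^ m * (p ^ R.card * (γ * (1 / 2) ^ m))) ^ 2 := by ring
      _ ≤ _ := pow_le_pow_left₀ (by positivity) hlow 2
      _ ≤ _ := h2nd
      _ ≤ q * (((n : ℝ) ^ m * p ^ R.card) ^ 2 * ((m : ℝ) + 1) ^ m) :=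
          mul_le_mul_of_nonneg_left hup hq0
      _ = _ := by ring
  rw [div_le_iff₀ (by positivity)]
  refine (le_of_mul_le_mul_left hmain (by positivity)).trans ?_
  refine mul_le_mul_of_nonneg_right ?_ (by positivity)
  refine subsetProb_mono hp0.le hp1 fun H hH hex => ?_
  obtain ⟨φ, -, hφ⟩ := hex
  exact hφ.appearsAsComponent hd hβ hR.conn hH

/-! ### Recovery below the ambiguity threshold -/

theorem mem_ambiguousDensities_of_isObstruction {d : ℕ} (hd : 2 ≤ d) {δ : ℝ}
    (hδ : δ ≤ (d - 1) / (d + 1)) {m : ℕ} {R : Finset (Finset (Fin m))}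
    (hR : IsObstruction d ((d : ℝ) - 1 - δ) R) : δ ∈ ambiguousDensities d := by
  have hdR : (2 : ℝ) ≤ d := by exact_mod_cast hd
  refine ⟨hδ.trans_lt ?_, m, proj R, hR.ambiguous, exists_le_prob_appearsAsComponent hd hδ hR⟩
  exact div_lt_self (by linarith) (by linarith)

theorem IsPreimage.exists_isMinPreimage {V : Type*} {d : ℕ} {G : SimpleGraph V}
    {H : Finset (Finset V)} (hH : IsPreimage d G H) : ∃ H₀, IsMinPreimage d G H₀ := by
  obtain ⟨H₀, h₀, hmin⟩ := WellFounded.has_min (measure Finset.card).wf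
    {H : Finset (Finset V) | IsPreimage d G H} ⟨H, hH⟩
  exact ⟨H₀, h₀, fun H' hH' => not_lt.1 (hmin H' hH')⟩

open Classical in
/-- The algorithm which returns a minimum preimage. -/
noncomputable def minPreimage {V : Type*} (d : ℕ) (G : SimpleGraph V) : Finset (Finset V) :=
  if h : ∃ H, IsMinPreimage d G H then h.choose else ∅

theorem isMinPreimage_minPreimage {V : Type*} {d : ℕ} {H : Finset (Finset V)}
    (hH : (H : Set (Finset V)).Sized d) : IsMinPreimage d (proj H) (minPreimage d (proj H)) := by
  have h : ∃ H₀, IsMinPreimage d (proj H) H₀ := IsPreimage.exists_isMinPreimage ⟨hH, rfl⟩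
  rw [minPreimage, dif_pos h]
  exact h.choose_spec

/-- A single failure on a typical hypergraph, for a single `n`, already produces a finite
obstruction, and hence ambiguity at `δ`. So failures occur only on the atypical event of vanishing
probability. -/
theorem exactRecoveryPossible_of_notMem {d : ℕ} (hd : 3 ≤ d) {δ : ℝ}
    (hδ : δ < (d - 1) / (d + 1)) (hmem : δ ∉ ambiguousDensities d) :
    ExactRecoveryPossible d δ := by
  have hdR : (3 : ℝ) ≤ d := by exact_mod_cast hd
  have hδ1 : δ < d - 1 := hδ.trans (div_lt_self (by linarith) (by linarith))
  have hβ : (d : ℝ) * (d - 1) < (d + 1) * ((d : ℝ) - 1 - δ) := by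
    rw [lt_div_iff₀ (by positivity)] at hδ
    nlinarith
  obtain ⟨L, hL⟩ := exists_isObstruction hd hβ
  refine ⟨fun n => minPreimage d, ?_⟩
  have hlim := (tendsto_prob_not_spansUpTo hδ1 L).const_sub 1
  rw [sub_zero] at hlim
  refine tendsto_of_tendsto_of_tendsto_of_le_of_le hlim tendsto_const_nhds
    (fun n => ?_) fun n => ?_
  · obtain ⟨hp, hp1⟩ := edgeProb_mem d δ hδ1 n
    simp only [prob_eq_subsetProb]
    have h1 := subsetProb_add_not (allHyperedges n d) (edgeProb d δ n)
      (SpansUpTo ((d : ℝ) - 1 - δ) L)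
    refine le_trans (by linarith) (subsetProb_mono (E := SpansUpTo ((d : ℝ) - 1 - δ) L) hp hp1
      fun H hH hspan => ?_)
    have hs := sized_of_subset_allHyperedges hH
    by_contra hne
    obtain ⟨R, hR⟩ := hL H _ hs hspan (isMinPreimage_minPreimage hs) hne
    exact hmem (mem_ambiguousDensities_of_isObstruction (by omega) hδ.le hR)
  · obtain ⟨hp, hp1⟩ := edgeProb_mem d δ hδ1 n
    simp only [prob_eq_subsetProb]
    exact subsetProb_le_one hp hp1

/-! ### The set of ambiguous densities -/

theorem exists_spansUpTo_of_le_prob {d : ℕ} {δ : ℝ} (hδ : δ < d - 1)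
    {E : ∀ n : ℕ, Finset (Finset (Fin n)) → Prop} {c : ℝ} (hc : 0 < c)
    (hE : ∀ᶠ n : ℕ in atTop, c ≤ prob n d (edgeProb d δ n) (E n)) (L : ℕ) :
    ∃ (n : ℕ) (H : Finset (Finset (Fin n))), (H : Set (Finset (Fin n))).Sized d ∧
      SpansUpTo ((d : ℝ) - 1 - δ) L H ∧ E n H := by
  obtain ⟨n, h1, h2⟩ :=
    (hE.and ((tendsto_prob_not_spansUpTo hδ L).eventually_lt_const hc)).exists
  obtain ⟨hp, hp1⟩ := edgeProb_mem d δ hδ n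
  by_contra! hcon
  refine absurd (h1.trans ?_) (not_le.2 h2)
  simp only [prob_eq_subsetProb]
  exact subsetProb_mono hp hp1 fun H hH hEH hspan =>
    hcon n H (sized_of_subset_allHyperedges hH) hspan hEH

/-- For `δ < -1` one has `β > d`, so even a single hyperedge is too dense to appear, while a
component needs one. -/
theorem neg_one_le_of_mem_ambiguousDensities {d : ℕ} (hd : 2 ≤ d) {δ : ℝ}
    (hmem : δ ∈ ambiguousDensities d) : -1 ≤ δ := by
  obtain ⟨hδ, m, Ga, -, c, hc, hE⟩ := hmem
  by_contra! hlt
  obtain ⟨n, H, hH, hspan, φ, hcomp⟩ := exists_spansUpTo_of_le_prob hδ hc hE 1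
  have hempty : H = ∅ := by
    refine Finset.eq_empty_of_forall_notMem fun h hh => ?_
    have := hspan {h} (by simpa using hh) (by simp)
    rw [Finset.singleton_biUnion, id, hH hh, Finset.card_singleton] at this
    push_cast at this
    linarith
  obtain ⟨hsub, ⟨t, ht⟩, -⟩ := isTwoConnComponent_iff.1 hcomp
  obtain ⟨hcov, hcard⟩ := mem_cliqueSet_proj.1 (hsub ht)
  obtain ⟨u, hu, v, hv, huv⟩ := Finset.one_lt_card.1 (by omega : 1 < t.card)
  obtain ⟨h, hh, -⟩ := hcov u hu v hv huv
  simp [hempty] at hh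

/-- Up to the critical density, the set of ambiguous densities is an upper set. -/
theorem mem_ambiguousDensities_of_le {d : ℕ} (hd : 2 ≤ d) {δ₁ δ : ℝ}
    (hmem : δ₁ ∈ ambiguousDensities d) (hle : δ₁ ≤ δ) (hδ : δ ≤ (d - 1) / (d + 1)) :
    δ ∈ ambiguousDensities d := by
  obtain ⟨hδ₁, m, Ga, hGa, c, hc, hE⟩ := hmem
  -- The bound `2 ^ m` covers every hypergraph on `m` vertices, so the whole component found
  -- satisfies `Spans` for `δ₁`, and a fortiori for the smaller `β` of `δ`.
  obtain ⟨n, H, hH, hspan, φ, hcomp⟩ := exists_spansUpTo_of_le_prob hδ₁ hc hE (2 ^ m)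
  set C := (Ga.map φ).cliqueSet d with hC
  have hproj := proj_restrict_eq hd hGa hH hcomp
  obtain ⟨S, hS⟩ := exists_eq_copy hd ⟨restrict_sized hH C, hproj⟩
  have hcard : (restrict H C).card ≤ 2 ^ m := by
    rw [hS, card_copy]
    simpa using Finset.card_le_univ S
  refine mem_ambiguousDensities_of_isObstruction hd hδ (R := restrict H C)
    ⟨restrict_sized hH C, ?_, ?_, fun T hT => ?_⟩
  · rw [hproj]
    exact hGa.map hd φ
  · rw [hproj]
    exact isTwoConnComponent_self hcomp
  · refine le_trans (mul_le_mul_of_nonneg_right (by linarith) (Nat.cast_nonneg _))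
      (hspan T (hT.trans (restrict_subset H C)) ((Finset.card_le_card hT).trans hcard))

/-! ### Impossibility of recovery -/

theorem not_exactRecoveryPossible {d : ℕ} {δ : ℝ}
    (h : ∀ A : ∀ n : ℕ, SimpleGraph (Fin n) → Finset (Finset (Fin n)), ∃ q < 1,
      ∀ᶠ n : ℕ in atTop, prob n d (edgeProb d δ n) (fun H => A n (proj H) = H) ≤ q) :
    ¬ ExactRecoveryPossible d δ := by
  rintro ⟨A, hA⟩
  obtain ⟨q, hq, hle⟩ := h A
  exact absurd (le_of_tendsto hA hle) (not_le.2 hq)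

theorem tendsto_edgeProb {d : ℕ} {δ : ℝ} (hδ : δ < d - 1) :
    Tendsto (edgeProb d δ) atTop (𝓝 0) := by
  have h := (tendsto_rpow_neg_atTop (sub_pos.2 hδ)).comp tendsto_natCast_atTop_atTop
  exact h.congr fun n => (edgeProb_eq d δ n).symm

theorem weight_le_weight {α : Type*} {R H H' : Finset α} {p : ℝ} (hp : 0 ≤ p) (hp2 : p ≤ 1 / 2)
    (hH : H.card ≤ R.card) (hle : H'.card ≤ H.card) : weight R p H ≤ weight R p H' := by
  obtain ⟨k, hk⟩ := Nat.exists_eq_add_of_le hle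
  have h1 : R.card - H'.card = R.card - H.card + k := by omega
  rw [weight, weight, h1, hk, pow_add, pow_add, ← hk]
  calc p ^ H'.card * p ^ k * (1 - p) ^ (R.card - H.card)
      ≤ p ^ H'.card * (1 - p) ^ k * (1 - p) ^ (R.card - H.card) := by
        refine mul_le_mul_of_nonneg_right (mul_le_mul_of_nonneg_left ?_ (pow_nonneg hp _))
          (pow_nonneg (by linarith) _)
        exact pow_le_pow_left₀ hp (by linarith) k
    _ = _ := by ring

/-- When an ambiguous component appears, every algorithm fails with probability at least
one half. -/
theorem prob_appearsAsComponent_le {d n m : ℕ} (hd : 2 ≤ d) {Ga : SimpleGraph (Fin m)}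
    (hGa : IsAmbiguous d Ga) {p : ℝ} (hp : 0 ≤ p) (hp2 : p ≤ 1 / 2)
    (A : SimpleGraph (Fin n) → Finset (Finset (Fin n))) :
    prob n d p (fun H => AppearsAsComponent d Ga (proj H)) ≤
      2 * (1 - prob n d p (fun H => A (proj H) = H)) := by
  classical
  simp only [prob_eq_subsetProb]
  set U := allHyperedges n d with hU
  have hp1 : p ≤ 1 := by linarith
  have hswap : ∀ H : Finset (Finset (Fin n)), ∃ H', H ⊆ U →
      AppearsAsComponent d Ga (proj H) → H' ≠ H ∧ IsPreimage d (proj H) H' ∧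
        H'.card ≤ H.card := by
    intro H
    by_cases h : H ⊆ U ∧ AppearsAsComponent d Ga (proj H)
    · obtain ⟨H', hH'⟩ :=
        exists_ne_card_le hd hGa (sized_of_subset_allHyperedges h.1) h.2
      exact ⟨H', fun _ _ => hH'⟩
    · exact ⟨∅, fun h1 h2 => absurd ⟨h1, h2⟩ h⟩
  choose f hf using hswap
  have h1 : subsetProb U p (fun H => AppearsAsComponent d Ga (proj H) ∧ A (proj H) = H) ≤
      subsetProb U p (fun H => ¬ A (proj H) = H) := by
    set S := U.powerset.filter fun H => AppearsAsComponent d Ga (proj H) ∧ A (proj H) = H with hS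
    have hmem : ∀ H ∈ S, H ⊆ U ∧ A (proj H) = H ∧ f H ≠ H ∧ IsPreimage d (proj H) (f H) ∧
        (f H).card ≤ H.card := fun H hH => by
      obtain ⟨h1, h2, h3⟩ := Finset.mem_filter.1 hH
      rw [Finset.mem_powerset] at h1
      exact ⟨h1, h3, hf H h1 h2⟩
    -- The exchange preserves the projection, from which `A` recovers the original `H`. For the same
    -- reason `A` fails on `f H`.
    have hinj : Set.InjOn f S := by
      intro H hH H' hH' heq
      obtain ⟨-, h2, -, h4, -⟩ := hmem H hH
      obtain ⟨-, h2', -, h4', -⟩ := hmem H' hH'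
      rw [← h2, ← h2', ← h4.2, ← h4'.2, heq]
    calc subsetProb U p (fun H => AppearsAsComponent d Ga (proj H) ∧ A (proj H) = H)
        = ∑ H ∈ S, weight U p H := by
          rw [subsetProb]
          congr!
      _ ≤ ∑ H ∈ S, weight U p (f H) := Finset.sum_le_sum fun H hH =>
          weight_le_weight hp hp2 (Finset.card_le_card (hmem H hH).1) (hmem H hH).2.2.2.2
      _ = ∑ H ∈ S.image f, weight U p H := (Finset.sum_image hinj).symm
      _ ≤ _ := by
          refine sum_weight_le_subsetProb hp hp1 fun H' hH' => ?_
          obtain ⟨H, hH, rfl⟩ := Finset.mem_image.1 hH'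
          obtain ⟨-, h2, h3, h4, -⟩ := hmem H hH
          refine ⟨subset_allHyperedges_of_sized h4.1, ?_⟩
          rw [h4.2, h2]
          exact h3.symm
  have h2 : subsetProb U p (fun H => AppearsAsComponent d Ga (proj H)) ≤
      subsetProb U p (fun H => AppearsAsComponent d Ga (proj H) ∧ A (proj H) = H) +
        subsetProb U p (fun H => ¬ A (proj H) = H) := by
    have h := subsetProb_exists_le (R := U) hp hp1 (Finset.univ : Finset Bool)
      fun b H => if b then AppearsAsComponent d Ga (proj H) ∧ A (proj H) = H
        else ¬ A (proj H) = H
    rw [Fintype.sum_bool] at h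
    simp only [if_true, Bool.false_eq_true, if_false] at h
    refine le_trans (subsetProb_mono hp hp1 fun H _ hH => ?_) h
    by_cases hA : A (proj H) = H
    · exact ⟨true, Finset.mem_univ _, by simpa using ⟨hH, hA⟩⟩
    · exact ⟨false, Finset.mem_univ _, by simpa using hA⟩
  have h3 := subsetProb_add_not U p fun H => A (proj H) = H
  linarith

theorem not_exactRecoveryPossible_of_mem {d : ℕ} (hd : 2 ≤ d) {δ : ℝ}
    (hmem : δ ∈ ambiguousDensities d) : ¬ ExactRecoveryPossible d δ := by
  obtain ⟨hδ, m, Ga, hGa, c, hc, hE⟩ := hmem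
  refine not_exactRecoveryPossible fun A => ⟨1 - c / 2, by linarith, ?_⟩
  filter_upwards [hE, (tendsto_edgeProb hδ).eventually_lt_const
    (by norm_num : (0 : ℝ) < 1 / 2)] with n h1 h2
  have := prob_appearsAsComponent_le hd hGa (edgeProb_mem d δ hδ n).1 h2.le (A n)
  linarith

/-- The pairs of vertices contained in some hyperedge. -/
def pairs {V : Type*} [DecidableEq V] (H : Finset (Finset V)) : Finset (Finset V) :=
  H.biUnion fun h => h.powersetCard 2

theorem proj_adj_iff_mem_pairs {V : Type*} [DecidableEq V] {H : Finset (Finset V)} {u v : V} :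
    (proj H).Adj u v ↔ u ≠ v ∧ {u, v} ∈ pairs H := by
  simp only [proj, pairs, Finset.mem_biUnion, Finset.mem_powersetCard]
  refine and_congr_right fun huv => exists_congr fun h => and_congr_right fun _ => ?_
  rw [Finset.card_pair huv, Finset.insert_subset_iff, Finset.singleton_subset_iff]
  simp

/-- Counting bound: the success probability of any algorithm is at most the generating function
of the number of edges of a graph. -/
theorem prob_success_le {d n : ℕ} {p x : ℝ} (hp : 0 ≤ p) (hp1 : p ≤ 1) (hx : 0 ≤ x) (hx1 : x ≤ 1)
    (hpx : p ≤ x ^ d.choose 2 * (1 - p))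
    (A : SimpleGraph (Fin n) → Finset (Finset (Fin n))) :
    prob n d p (fun H => A (proj H) = H) ≤ (x + 1) ^ n.choose 2 * (1 - p) ^ n.choose d := by
  classical
  rw [prob_eq_subsetProb]
  have hcard : (allHyperedges n d).card = n.choose d := by simp [allHyperedges]
  set S := (allHyperedges n d).powerset.filter fun H => A (proj H) = H with hS
  -- The pairs determine the projection, and on a success `A` determines `H` from it.
  have hinj : Set.InjOn pairs (S : Set (Finset (Finset (Fin n)))) := by
    intro H hH H' hH' heq
    rw [← (Finset.mem_filter.1 hH).2, ← (Finset.mem_filter.1 hH').2]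
    congr 1
    ext u v
    rw [proj_adj_iff_mem_pairs, proj_adj_iff_mem_pairs, heq]
  calc subsetProb (allHyperedges n d) p (fun H => A (proj H) = H)
      = ∑ H ∈ S, weight (allHyperedges n d) p H := by
        rw [subsetProb]
        congr!
    _ ≤ ∑ H ∈ S, x ^ (pairs H).card * (1 - p) ^ n.choose d := by
        refine Finset.sum_le_sum fun H hH => ?_
        have hHU := Finset.mem_powerset.1 (Finset.mem_filter.1 hH).1
        have hle : H.card ≤ n.choose d := hcard ▸ Finset.card_le_card hHU
        have hpc : (pairs H).card ≤ H.card * d.choose 2 :=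
          Finset.card_biUnion_le_card_mul _ _ _ fun h hh => by
            rw [Finset.card_powersetCard, sized_of_subset_allHyperedges hHU hh]
        calc weight (allHyperedges n d) p H
            = p ^ H.card * (1 - p) ^ (n.choose d - H.card) := by rw [weight, hcard]
          _ ≤ (x ^ d.choose 2 * (1 - p)) ^ H.card * (1 - p) ^ (n.choose d - H.card) :=
              mul_le_mul_of_nonneg_right (pow_le_pow_left₀ hp hpx _)
                (pow_nonneg (by linarith) _)
          _ = x ^ (H.card * d.choose 2) * (1 - p) ^ n.choose d := by
              rw [mul_pow, mul_assoc, ← pow_add, Nat.add_sub_cancel' hle, ← pow_mul,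
                mul_comm H.card]
          _ ≤ _ := mul_le_mul_of_nonneg_right (pow_le_pow_of_le_one hx hx1 hpc)
              (pow_nonneg (by linarith) _)
    _ = (∑ E ∈ S.image pairs, x ^ E.card) * (1 - p) ^ n.choose d := by
        rw [Finset.sum_image hinj, Finset.sum_mul]
    _ ≤ (∑ E ∈ (Finset.powersetCard 2 (Finset.univ : Finset (Fin n))).powerset, x ^ E.card) *
        (1 - p) ^ n.choose d := by
        refine mul_le_mul_of_nonneg_right ?_ (pow_nonneg (by linarith) _)
        refine Finset.sum_le_sum_of_subset_of_nonneg (fun E hE => ?_)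
          fun _ _ _ => pow_nonneg hx _
        obtain ⟨H, -, rfl⟩ := Finset.mem_image.1 hE
        refine Finset.mem_powerset.2 (Finset.biUnion_subset.2 fun h _ => ?_)
        exact Finset.powersetCard_mono (Finset.subset_univ h)
    _ = _ := by
        have h := Finset.sum_pow_mul_eq_add_pow x 1
          (Finset.powersetCard 2 (Finset.univ : Finset (Fin n)))
        simp only [one_pow, mul_one, Finset.card_powersetCard, Finset.card_univ,
          Fintype.card_fin] at h
        rw [h]

theorem half_pow_div_le_choose {n d : ℕ} (h : 2 * d ≤ n) :
    ((n : ℝ) / 2) ^ d / d.factorial ≤ n.choose d := by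
  rw [div_le_iff₀ (by positivity)]
  have h1 : (n + 1 - d) ^ d ≤ n.choose d * d.factorial := by
    rw [mul_comm, ← Nat.descFactorial_eq_factorial_mul_choose]
    exact Nat.pow_sub_le_descFactorial n d
  refine le_trans ?_ (by exact_mod_cast h1 : ((n + 1 - d : ℕ) : ℝ) ^ d ≤ _)
  refine pow_le_pow_left₀ (by positivity) ?_ d
  rw [Nat.cast_sub (by omega)]
  have : (2 : ℝ) * d ≤ n := by exact_mod_cast h
  push_cast
  linarith

/-- Above the critical density there are too many hypergraphs for exact recovery. -/
theorem not_exactRecoveryPossible_of_critical_lt {d : ℕ} (hd : 3 ≤ d) {δ : ℝ}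
    (hδ : ((d : ℝ) - 1) / (d + 1) < δ) (hδ1 : δ < d - 1) : ¬ ExactRecoveryPossible d δ := by
  have hdR : (3 : ℝ) ≤ d := by exact_mod_cast hd
  rw [div_lt_iff₀ (by positivity)] at hδ
  set β := (d : ℝ) - 1 - δ with hβ
  have hβ0 : 0 < β := sub_pos.2 hδ1
  have hD1 : 1 ≤ d.choose 2 := Nat.choose_pos (by omega)
  have hD : (d.choose 2 : ℝ) = d * (d - 1) / 2 := Nat.cast_choose_two ℝ d
  have hDpos : (0 : ℝ) < d.choose 2 := by exact_mod_cast hD1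
  have hdβ : 0 < (d : ℝ) - β := by
    have : 0 < δ := by nlinarith
    linarith
  -- With `D = d.choose 2`, positivity means `β (D - 1) < (d - 2) D`. As `D - 1 = (d-2)(d+1)/2`,
  -- this is `β < d(d-1)/(d+1)`, the supercritical hypothesis.
  have hη : 0 < (d : ℝ) - β - (2 - β / d.choose 2) := by
    have h1 : 0 < ((d : ℝ) - β) * d.choose 2 - (2 * d.choose 2 - β) := by
      rw [hD]
      nlinarith
    have h2 : (d : ℝ) - β - (2 - β / d.choose 2) =
        (((d : ℝ) - β) * d.choose 2 - (2 * d.choose 2 - β)) / d.choose 2 := by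
      field_simp
    rw [h2]
    exact div_pos h1 hDpos
  set η := (d : ℝ) - β - (2 - β / d.choose 2) with hηdef
  set c : ℝ := 1 / (2 ^ d * d.factorial) with hc
  have hc0 : 0 < c := by positivity
  refine not_exactRecoveryPossible fun A =>
    ⟨Real.exp (-(c / 2)), by rw [Real.exp_lt_one_iff]; linarith, ?_⟩
  have hlim : ∀ {a : ℝ}, 0 < a → Tendsto (fun n : ℕ => (n : ℝ) ^ (-a)) atTop (𝓝 0) := fun ha =>
    (tendsto_rpow_neg_atTop ha).comp tendsto_natCast_atTop_atTop
  filter_upwards [(tendsto_edgeProb hδ1).eventually_lt_const (by norm_num : (0 : ℝ) < 1 / 2),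
    (hlim (div_pos hβ0 hDpos)).eventually_lt_const (by norm_num : (0 : ℝ) < 1 / 2),
    (hlim hη).eventually_lt_const (by positivity : 0 < c / 4),
    eventually_ge_atTop (2 * d)] with n hp2 hx2 hη2 hn
  have hn0 : 0 < n := by omega
  have hn1 : (1 : ℝ) ≤ n := by exact_mod_cast hn0
  have hnpos : (0 : ℝ) < n := by linarith
  obtain ⟨hp0, hp1⟩ := edgeProb_mem d δ hδ1 n
  -- About the `D`-th root of `p`, for `D = d.choose 2`. The factor `2` gives `x ^ D ≥ 2p`, which
  -- absorbs `1 - p ≥ 1/2`.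
  set x := 2 * (n : ℝ) ^ (-(β / d.choose 2)) with hx
  have hx0 : 0 ≤ x := by positivity
  have hxp : 2 * edgeProb d δ n ≤ x ^ d.choose 2 := by
    rw [hx, mul_pow, rpow_neg_pow, div_mul_cancel₀ _ hDpos.ne', edgeProb_eq]
    refine mul_le_mul_of_nonneg_right ?_ (by positivity)
    calc (2 : ℝ) = 2 ^ 1 := (pow_one 2).symm
      _ ≤ 2 ^ d.choose 2 := pow_le_pow_right₀ (by norm_num) hD1
  refine (prob_success_le hp0 hp1 hx0 (by linarith) ?_ (A n)).trans ?_
  · nlinarith [pow_nonneg hx0 (d.choose 2)]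
  have h1 : (x + 1) ^ n.choose 2 ≤ Real.exp (2 * (n : ℝ) ^ (2 - β / d.choose 2)) := by
    calc (x + 1) ^ n.choose 2 ≤ Real.exp x ^ n.choose 2 :=
          pow_le_pow_left₀ (by linarith) (Real.add_one_le_exp x) _
      _ = Real.exp (n.choose 2 * x) := (Real.exp_nat_mul x _).symm
      _ ≤ Real.exp ((n : ℝ) ^ 2 * x) := by
          refine Real.exp_le_exp.2 (mul_le_mul_of_nonneg_right ?_ hx0)
          exact_mod_cast Nat.choose_le_pow n 2
      _ = _ := by
          rw [hx, sub_eq_add_neg, Real.rpow_add hnpos, Real.rpow_ofNat]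
          ring_nf
  have h2 : (1 - edgeProb d δ n) ^ n.choose d ≤ Real.exp (-(c * (n : ℝ) ^ ((d : ℝ) - β))) := by
    calc (1 - edgeProb d δ n) ^ n.choose d
        ≤ Real.exp (-edgeProb d δ n) ^ n.choose d :=
          pow_le_pow_left₀ (by linarith) (Real.one_sub_le_exp_neg _) _
      _ = Real.exp (n.choose d * -edgeProb d δ n) := (Real.exp_nat_mul _ _).symm
      _ ≤ _ := by
          refine Real.exp_le_exp.2 ?_
          rw [mul_neg, neg_le_neg_iff]
          refine le_trans (le_of_eq ?_)
            (mul_le_mul_of_nonneg_right (half_pow_div_le_choose hn) hp0)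
          rw [edgeProb_eq, ← hβ, sub_eq_add_neg, Real.rpow_add hnpos, Real.rpow_natCast, hc,
            div_pow]
          field_simp
  have h3 : (n : ℝ) ^ (2 - β / d.choose 2) = (n : ℝ) ^ ((d : ℝ) - β) * (n : ℝ) ^ (-η) := by
    rw [← Real.rpow_add hnpos, hηdef]
    ring_nf
  have h4 : 1 ≤ (n : ℝ) ^ ((d : ℝ) - β) := Real.one_le_rpow hn1 hdβ.le
  calc (x + 1) ^ n.choose 2 * (1 - edgeProb d δ n) ^ n.choose d
      ≤ Real.exp (2 * (n : ℝ) ^ (2 - β / d.choose 2)) *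
        Real.exp (-(c * (n : ℝ) ^ ((d : ℝ) - β))) :=
        mul_le_mul h1 h2 (pow_nonneg (by linarith) _) (Real.exp_pos _).le
    _ = Real.exp (2 * (n : ℝ) ^ (2 - β / d.choose 2) - c * (n : ℝ) ^ ((d : ℝ) - β)) := by
        rw [← Real.exp_add, ← sub_eq_add_neg]
    _ ≤ _ := by
        refine Real.exp_le_exp.2 ?_
        rw [h3]
        nlinarith

end HypergraphProjection

/-! ### The two thresholds coincide -/

open HypergraphProjection in
theorem mainTheorem6 (d : ℕ) (hd : d = 3 ∨ d = 4 ∨ d = 5) :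
    -- both thresholds are genuine (the infimum and supremum defining them exist)
    IsGLB (HypergraphProjection.ambiguousDensities d)
      (HypergraphProjection.ambiguityThreshold d) ∧
    IsLUB (HypergraphProjection.recoverableDensities d)
      (HypergraphProjection.criticalThreshold d) ∧
    HypergraphProjection.ambiguityThreshold d ≤ ((d : ℝ) - 1) / ((d : ℝ) + 1) ∧
    HypergraphProjection.criticalThreshold d = HypergraphProjection.ambiguityThreshold d ∧
    -- and the recovery transition at the common value is sharp
    (∀ δ : ℝ, δ < HypergraphProjection.criticalThreshold d →
      HypergraphProjection.ExactRecoveryPossible d δ) ∧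
    (∀ δ : ℝ, HypergraphProjection.criticalThreshold d < δ → δ < (d : ℝ) - 1 →
      ¬ HypergraphProjection.ExactRecoveryPossible d δ) := by
  have hd3 : 3 ≤ d := by omega
  have hd2 : 2 ≤ d := by omega
  have hdR : (3 : ℝ) ≤ d := by exact_mod_cast hd3
  have hcrit : ((d : ℝ) - 1) / (d + 1) ∈ ambiguousDensities d := by
    obtain ⟨m, R, hR⟩ := exists_isObstruction_critical hd3 (by omega)
    refine mem_ambiguousDensities_of_isObstruction hd2 le_rfl (R := R) ?_
    convert hR using 1
    field_simp
    ring
  have hbdd : BddBelow (ambiguousDensities d) :=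
    ⟨-1, fun δ hδ => neg_one_le_of_mem_ambiguousDensities hd2 hδ⟩
  have hGLB : IsGLB (ambiguousDensities d) (ambiguityThreshold d) :=
    isGLB_csInf ⟨_, hcrit⟩ hbdd
  have hle : ambiguityThreshold d ≤ ((d : ℝ) - 1) / (d + 1) := hGLB.1 hcrit
  have hlt : ((d : ℝ) - 1) / (d + 1) < d - 1 := div_lt_self (by linarith) (by linarith)
  have hrec : ∀ δ < ambiguityThreshold d, ExactRecoveryPossible d δ := fun δ hδ =>
    exactRecoveryPossible_of_notMem hd3 (hδ.trans_le hle) fun hmem =>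
      absurd (hGLB.1 hmem) (not_le.2 hδ)
  have hnot : ∀ δ, ambiguityThreshold d < δ → δ < (d : ℝ) - 1 →
      ¬ ExactRecoveryPossible d δ := by
    intro δ hδ hδ1
    -- Up to the critical value ambiguity propagates upwards from some `δ₁ < δ`; beyond it the
    -- counting bound takes over.
    rcases le_or_gt δ (((d : ℝ) - 1) / (d + 1)) with h | h
    · obtain ⟨δ₁, hmem, -, hδ₁⟩ := hGLB.exists_between hδ
      exact not_exactRecoveryPossible_of_mem hd2
        (mem_ambiguousDensities_of_le hd2 hmem hδ₁.le h)
    · exact not_exactRecoveryPossible_of_critical_lt hd3 h hδ1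
  have hLUB : IsLUB (recoverableDensities d) (ambiguityThreshold d) := by
    refine ⟨fun δ hδ => not_lt.1 fun h => hnot δ h hδ.1 hδ.2, fun b hb => ?_⟩
    refine le_of_forall_lt_imp_le_of_dense fun δ hδ => ?_
    exact hb ⟨hδ.trans_le (hle.trans hlt.le), hrec δ hδ⟩
  have heq : criticalThreshold d = ambiguityThreshold d := hLUB.csSup_eq
    ⟨_, ((sub_one_lt _).trans_le (hle.trans hlt.le)), hrec _ (sub_one_lt _)⟩
  rw [heq]
  exact ⟨hGLB, hLUB, hle, rfl, hrec, hnot⟩
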